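/- Let $p:(\mathcal X,\omega)\to\mathcal B$ be a relative Kähler fibration, i.e. $p$ is a proper holomorphic submersion between complex manifolds and $\omega$ is a real, smooth, $d$-closed $(1,1)$-form on $\mathcal X$ which is positive on each fiber $X_t:=p^{-1}(t)$. Let $m=\dim_{\mathbb C}\mathcal B$ and let $n$ be the complex dimension of the fibers. For complex tangent vectors $V,W$ of $\mathcal X$ at a point put $\langle V,W\rangle_\omega=\omega(V,J\overline W)$, where $J$ is the complex structure and $\omega, J$ are extended complex (bi)linearly. A complex vector is vertical if $p_*$ kills it, and $V$ is horizontal if $\omega(V,W)=0$ for all vertical $W$. Let $(t^1,\dots,t^m)$ be holomorphic coordinates on an open set $U\subset\mathcal B$. On $p^{-1}(U)$ let $V_j$ be the horizontal lift of $\partial/\partial t^j$, i.e. the horizontal complex vector field with $p_*V_j=\partial/\partial t^j$ (it exists, is unique and is smooth), and let $$c_{j\bar k}=\langle V_j,V_k\rangle_\omega,\qquad c(\omega)=i\sum_{j,k}c_{j\bar k}\,dt^j\wedge d\bar t^k,\qquad \omega'=\omega-c(\omega)$$ (the functions $c_{j\bar k}$ are smooth). Then the following hold on $p^{-1}(U)$.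 1. $[V_j,V_k]=0$ for all $j,k$. 2. $(\omega')^{n+1}\equiv 0$. 3. For all $j,k$ and all $t\in U$, the field $[V_j,\overline{V_k}]$ is vertical and $$[V_j,\overline{V_k}]\,\rfloor\,(\omega|_{X_t})=i\,(dc_{j\bar k})|_{X_t}.$$ 4. $[V_j,\overline{V_k}]\equiv 0$ on $p^{-1}(U)$ for all $j,k$ if and only if $d\omega'=0$ on $p^{-1}(U)$. -/

import Mathlib

open scoped Manifold ContDiff Topology

/-! ### Complexification of a real vector space -/

/-- An element `re + i im` of the complexification `V ⊗ ℂ` of a real vector space `V`. -/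
@[ext]
structure Cplx (V : Type*) where
  re : V
  im : V

namespace Cplx

variable {V W : Type*} [AddCommGroup V] [AddCommGroup W]

instance : Zero (Cplx V) := ⟨⟨0, 0⟩⟩

/-- Complex conjugation `re + i im ↦ re - i im`. -/
def conj (Z : Cplx V) : Cplx V := ⟨Z.re, -Z.im⟩

/-- The complex linear extension of a real linear map. -/
def map [Module ℝ V] [Module ℝ W] (f : V →ₗ[ℝ] W) (Z : Cplx V) : Cplx W := ⟨f Z.re, f Z.im⟩

end Cplx

/-! ### Multilinear algebra of complex-valued forms on a real vector space -/

section Algebra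

variable {V : Type*} [AddCommGroup V] [Module ℝ V] [TopologicalSpace V]

/-- The complex bilinear extension of a complex-valued 2-form to the complexification. -/
noncomputable def evalCplx (η : V [⋀^Fin 2]→L[ℝ] ℂ) (Z W : Cplx V) : ℂ :=
  η ![Z.re, W.re] - η ![Z.im, W.im] + Complex.I * (η ![Z.re, W.im] + η ![Z.im, W.re])

/-- The wedge product of two 1-forms, `(α ∧ β)(v, w) = α v * β w - α w * β v`. -/
noncomputable def wedgeOne (α β : V →L[ℝ] ℂ) : V [⋀^Fin 2]→L[ℝ] ℂ :=
  ContinuousMultilinearMap.alternatization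
    ((ContinuousMultilinearMap.mkPiAlgebra ℝ (Fin 2) ℂ).compContinuousLinearMap ![α, β])

theorem wedgeOne_apply (α β : V →L[ℝ] ℂ) (v : Fin 2 → V) :
    wedgeOne α β v = α (v 0) * β (v 1) - α (v 1) * β (v 0) := by
  have h : (Finset.univ : Finset (Equiv.Perm (Fin 2))) = {1, Equiv.swap 0 1} := by decide
  have h' : (1 : Equiv.Perm (Fin 2)) ≠ Equiv.swap 0 1 := by decide
  simp only [wedgeOne, ContinuousMultilinearMap.alternatization_apply_apply, h,
    Finset.sum_pair h']
  simp [Fin.prod_univ_two, sub_eq_add_neg]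

/-- The value on `v` of the `k`-th exterior power `η ∧ ⋯ ∧ η` of a 2-form, a form of
degree `2 * k`. -/
noncomputable def wedgePow (η : V [⋀^Fin 2]→L[ℝ] ℂ) (k : ℕ) (v : Fin (2 * k) → V) : ℂ :=
  (1 / 2 ^ k : ℂ) * ∑ σ : Equiv.Perm (Fin (2 * k)), ((Equiv.Perm.sign σ : ℤ) : ℂ) *
    ∏ i : Fin k, η ![v (σ ⟨2 * i, by omega⟩), v (σ ⟨2 * i + 1, by omega⟩)]

end Algebra

/-! ### Forms and vector fields on a complex manifold, seen as a real manifold -/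

section Manifolds

variable {E : Type*} [NormedAddCommGroup E] [NormedSpace ℂ E]
  {X : Type*} [TopologicalSpace X] [ChartedSpace E X]
  {F : Type*} [NormedAddCommGroup F] [NormedSpace ℂ F]
  {B : Type*} [TopologicalSpace B] [ChartedSpace F B]

/-- A complex manifold is a real analytic (in particular smooth) real manifold. -/
theorem isManifold_real_of_complex [IsManifold 𝓘(ℂ, E) ω X] : IsManifold 𝓘(ℝ, E) ω X := by
  apply isManifold_of_contDiffOn
  intro e e' he he'
  have h := (contDiffGroupoid ω 𝓘(ℂ, E)).compatible he he'
  rw [contDiffGroupoid, mem_groupoid_of_pregroupoid] at h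
  simpa [contDiffPregroupoid] using (h.1 : ContDiffOn ℂ ω _ _).restrict_scalars ℝ

instance [IsManifold 𝓘(ℂ, E) ω X] : IsManifold 𝓘(ℝ, E) 1 X :=
  haveI : IsManifold 𝓘(ℝ, E) ω X := isManifold_real_of_complex
  IsManifold.of_le (n := ω) le_top

/-- Complex-valued differential `k`-forms on the real manifold underlying `X`, without any
smoothness. -/
abbrev CForm (E : Type*) [NormedAddCommGroup E] [NormedSpace ℂ E]
    (X : Type*) [TopologicalSpace X] [ChartedSpace E X] (k : ℕ) :=
  ∀ x : X, TangentSpace 𝓘(ℝ, E) x [⋀^Fin k]→L[ℝ] ℂ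

/-- Complex vector fields, i.e. sections of `TX ⊗ ℂ`, without any smoothness. -/
abbrev CField (E : Type*) [NormedAddCommGroup E] [NormedSpace ℂ E]
    (X : Type*) [TopologicalSpace X] [ChartedSpace E X] :=
  ∀ x : X, Cplx (TangentSpace 𝓘(ℝ, E) x)

/-- The complex structure `J` on the real tangent space. The tangent space at `x` is identified
with `E` through a holomorphic chart, so `J` is multiplication by `i` on `E`. -/
noncomputable def tangentJ (x : X) : TangentSpace 𝓘(ℝ, E) x →L[ℝ] TangentSpace 𝓘(ℝ, E) x :=
  (Complex.I • ContinuousLinearMap.id ℝ E : E →L[ℝ] E)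

/-- The representative of a form in the preferred chart at `x₀`. -/
noncomputable def chartForm {k : ℕ} (η : CForm E X k) (x₀ : X) (y : E) : E [⋀^Fin k]→L[ℝ] ℂ :=
  (η ((extChartAt 𝓘(ℝ, E) x₀).symm y)).compContinuousLinearMap
    (mfderiv 𝓘(ℝ, E) 𝓘(ℝ, E) (extChartAt 𝓘(ℝ, E) x₀).symm y)

/-- A form is smooth if all its representatives in charts are. -/
def IsSmoothForm {k : ℕ} (η : CForm E X k) : Prop :=
  ∀ x₀ : X, ContDiffOn ℝ ∞ (chartForm η x₀) (extChartAt 𝓘(ℝ, E) x₀).target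

/-- The exterior derivative of a form, computed at `x` in the preferred chart at `x`. -/
noncomputable def mextDeriv {k : ℕ} (η : CForm E X k) : CForm E X (k + 1) := fun x =>
  (extDeriv (chartForm η x) (extChartAt 𝓘(ℝ, E) x x)).compContinuousLinearMap
    (mfderiv 𝓘(ℝ, E) 𝓘(ℝ, E) (extChartAt 𝓘(ℝ, E) x) x)

/-- Smoothness on `s` of a complex vector field: its real and imaginary parts are smooth sections
of the tangent bundle. -/
def IsSmoothCFieldOn [IsManifold 𝓘(ℂ, E) ω X] (Z : CField E X) (s : Set X) : Prop :=
  ContMDiffOn 𝓘(ℝ, E) 𝓘(ℝ, E).tangent ∞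
      (fun x => (⟨x, (Z x).re⟩ : TangentBundle 𝓘(ℝ, E) X)) s ∧
    ContMDiffOn 𝓘(ℝ, E) 𝓘(ℝ, E).tangent ∞
      (fun x => (⟨x, (Z x).im⟩ : TangentBundle 𝓘(ℝ, E) X)) s

/-- The conjugate of a complex vector field. -/
noncomputable def CField.conj (Z : CField E X) : CField E X := fun x => (Z x).conj

/-- The differential of a complex-valued function, as a complex-valued 1-form. -/
noncomputable def cDiff (f : X → ℂ) (x : X) : TangentSpace 𝓘(ℝ, E) x →L[ℝ] ℂ :=
  mfderiv 𝓘(ℝ, E) 𝓘(ℝ, ℂ) f x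

/-- The complex bilinear extension of the Lie bracket to complex vector fields. -/
noncomputable def cBracket (Z W : CField E X) : CField E X := fun x =>
  ⟨VectorField.mlieBracket 𝓘(ℝ, E) (fun y => (Z y).re) (fun y => (W y).re) x
      - VectorField.mlieBracket 𝓘(ℝ, E) (fun y => (Z y).im) (fun y => (W y).im) x,
    VectorField.mlieBracket 𝓘(ℝ, E) (fun y => (Z y).re) (fun y => (W y).im) x
      + VectorField.mlieBracket 𝓘(ℝ, E) (fun y => (Z y).im) (fun y => (W y).re) x⟩

/-! ### Relative Kähler fibrations -/

/-- A real tangent vector is vertical if it is tangent to the fiber of `p`. -/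
def IsVertical (p : X → B) (x : X) (w : TangentSpace 𝓘(ℝ, E) x) : Prop :=
  mfderiv 𝓘(ℝ, E) 𝓘(ℝ, F) p x w = 0

/-- A complex tangent vector is vertical if its real and imaginary parts are. -/
def IsVerticalC (p : X → B) (x : X) (Z : Cplx (TangentSpace 𝓘(ℝ, E) x)) : Prop :=
  IsVertical (F := F) p x Z.re ∧ IsVertical (F := F) p x Z.im

/-- `p : (X, Ω) → B` is a relative Kähler fibration: `p` is a proper holomorphic submersion and
`Ω` is a real smooth closed `(1,1)`-form, positive on the fibers of `p`. -/
structure IsRelativeKahlerFibration (p : X → B) (Ω : CForm E X 2) : Prop where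
  proper : IsProperMap p
  holomorphic : ContMDiff 𝓘(ℂ, E) 𝓘(ℂ, F) ω p
  submersion : ∀ x, Function.Surjective (mfderiv 𝓘(ℂ, E) 𝓘(ℂ, F) p x)
  smooth : IsSmoothForm Ω
  real : ∀ x v, (starRingEnd ℂ) (Ω x v) = Ω x v
  closed : ∀ x, mextDeriv Ω x = 0
  type_one_one : ∀ x v w, Ω x ![tangentJ x v, tangentJ x w] = Ω x ![v, w]
  positive : ∀ x v, IsVertical (F := F) p x v → v ≠ 0 → 0 < (Ω x ![v, tangentJ x v]).re

/-- The complex vector `Z` at `x` is horizontal and is mapped by `p` to the complex vector `u`. -/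
def IsHorizontalLiftAt (p : X → B) (Ω : CForm E X 2) (x : X)
    (u : Cplx (TangentSpace 𝓘(ℝ, F) (p x))) (Z : Cplx (TangentSpace 𝓘(ℝ, E) x)) : Prop :=
  (∀ W, IsVerticalC (F := F) p x W → evalCplx (Ω x) Z W = 0) ∧
    Cplx.map (mfderiv 𝓘(ℝ, E) 𝓘(ℝ, F) p x).toLinearMap Z = u

open Classical in
/-- The horizontal lift of a complex vector field on the base (zero where there is none). -/
noncomputable def horizontalLift (p : X → B) (Ω : CForm E X 2) (u : CField F B) : CField E X :=
  fun x => if h : ∃ Z, IsHorizontalLiftAt p Ω x (u (p x)) Z then h.choose else 0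

/-- The inner product `⟨Z, W⟩ = Ω(Z, J W̄)` of two complex tangent vectors. -/
noncomputable def innerForm (Ω : CForm E X 2) (x : X) (Z W : Cplx (TangentSpace 𝓘(ℝ, E) x)) : ℂ :=
  evalCplx (Ω x) Z (W.conj.map (tangentJ x).toLinearMap)

/-! ### Objects attached to holomorphic coordinates on the base

Holomorphic coordinates on an open subset of `B` are given by a chart `t` with values in the model
space `F` and a complex basis `b` of `F`: the `j`-th coordinate `t^j` is the `j`-th coordinate of
`t` with respect to `b`. -/

section Coordinates

variable {m : ℕ} (t : OpenPartialHomeomorph B F) (b : Module.Basis (Fin m) ℂ F)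

/-- The real differential of `t` at `y`. -/
noncomputable def chartDiff (y : B) : TangentSpace 𝓘(ℝ, F) y →L[ℝ] F :=
  mfderiv 𝓘(ℝ, F) 𝓘(ℝ, F) t y

/-- The complex vector field `∂/∂t^j = (∂/∂x^j - i ∂/∂y^j) / 2` on the base,
where `t^j = x^j + i y^j`. -/
noncomputable def coordField (j : Fin m) : CField F B := fun y =>
  ⟨(1 / 2 : ℝ) • (chartDiff t y).inverse (b j),
    -((1 / 2 : ℝ) • (chartDiff t y).inverse (Complex.I • b j))⟩

/-- The pull-back to `X` of the 1-form `dt^j`. -/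
noncomputable def coordDiff (p : X → B) (j : Fin m) (x : X) : TangentSpace 𝓘(ℝ, E) x →L[ℝ] ℂ :=
  cDiff (fun y => b.repr (t (p y)) j) x

/-- The horizontal lift `V_j` of `∂/∂t^j`. -/
noncomputable def liftV (p : X → B) (Ω : CForm E X 2) (j : Fin m) : CField E X :=
  horizontalLift p Ω (coordField t b j)

/-- The geodesic curvatures `c_{j k̄} = ⟨V_j, V_k⟩`. -/
noncomputable def geodCurv (p : X → B) (Ω : CForm E X 2) (j k : Fin m) (x : X) : ℂ :=
  innerForm Ω x (liftV t b p Ω j x) (liftV t b p Ω k x)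

/-- The geodesic curvature form `c(Ω) = i ∑ c_{j k̄} dt^j ∧ dt̄^k`. -/
noncomputable def geodForm (p : X → B) (Ω : CForm E X 2) : CForm E X 2 := fun x =>
  Complex.I • ∑ j : Fin m, ∑ k : Fin m, geodCurv t b p Ω j k x •
    wedgeOne (coordDiff t b p j x)
      ((Complex.conjCLE : ℂ →L[ℝ] ℂ).comp (coordDiff t b p k x))

end Coordinates

end Manifolds

/-!
Every assertion is local on the total space, and every operator involved (`mextDeriv`,
`mlieBracket`, `mfderiv`) is computed at `x` in the preferred chart at `x`, whose differential at
`x` is the identity. So the fibration is replaced near `x` by an open subset of the model space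
`E`, with a projection `q : E → F` in the coordinates `t` of the base and a closed form `η`
(`IsLocalFibration`).

Positivity on the fibers makes the form nondegenerate on vertical vectors, so there is a unique
real horizontal lift `L u` of a vector `u` of the base (`IsPosOnKer.exists_isLift`). It depends
smoothly on the point (`contDiffAt_realLift`) and is complex linear, as the form is of type
`(1,1)`. The complex lift of `∂/∂t^j = (∂/∂x^j - i ∂/∂y^j) / 2` is made of the `L u` for two
constant vectors `u`.

The central identity is `toBilin_lieBracket_liftField`: for constant `u`, `v` and vertical `w`,
the vector `[L u, L v]` is vertical and `η([L u, L v], w) = d(η(L u, L v))(w)`. It is the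
invariant formula for `dη = 0` on `(L u, L v, w)`, all of whose other terms vanish by
orthogonality. As `η(L u, L v)` does not change when `u` and `v` are both multiplied by `i`,
neither does `[L u, L v]` (`liftBracket_I`). Expanding the complex brackets, this invariance gives
`[V_j, V_k] = 0` (`cBracket_liftV`), and the identity itself gives the contraction of `[V_j,
V̄_k]` (`evalCplx_cBracket_conj`).

The form `c(Ω)` is the part of `Ω` living on horizontal vectors, because it is the expansion of
that form of type `(1,1)` in the coordinates of the base. Hence `Ω' = Ω - c(Ω)` is `Ω(P ·, P ·)`,
where `P` is the projection onto vertical vectors along horizontal ones (`sub_geodForm_eq`). The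
image of `P` has real dimension `2 n`, so the power `n + 1` of `Ω'` vanishes. Finally, in the
splitting of tangent vectors into horizontal and vertical parts, the only component of `dΩ'` which
does not vanish automatically is `dΩ'(L u, L v, w) = -Ω([L u, L v], w)`; so `Ω'` is closed if and
only if all `[L u, L v]` vanish (`extDeriv_vertForm_eq_zero_iff`), which means that all `[V_j,
V̄_k]` do (`cBracket_conj_eq_zero_iff`).
-/

/-! ### Alternating 2-forms as bilinear maps -/

section Bilin

variable {E : Type*} [NormedAddCommGroup E] [NormedSpace ℝ E]

/-- The bilinear map underlying a 2-form, as a continuous linear function of the form. -/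
noncomputable def toBilin : (E [⋀^Fin 2]→L[ℝ] ℂ) →L[ℝ] E →L[ℝ] E →L[ℝ] ℂ :=
  (ContinuousLinearMap.compL ℝ E (E [⋀^Fin 1]→L[ℝ] ℂ) (E →L[ℝ] ℂ)
    (ContinuousAlternatingMap.ofSubsingletonLIE (𝕜 := ℝ) (E := E) (F := ℂ)
      (0 : Fin 1)).symm.toContinuousLinearEquiv.toContinuousLinearMap) ∘L
    (ContinuousAlternatingMap.curryLeftLI (𝕜 := ℝ) (E := E) (F := ℂ) (n := 1)).toContinuousLinearMap

theorem contDiff_toBilin {n : ℕ∞ω} : ContDiff ℝ n (toBilin (E := E)) := by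
  fun_prop

theorem toBilin_apply (η : E [⋀^Fin 2]→L[ℝ] ℂ) (v w : E) : toBilin η v w = η ![v, w] := by
  have e : Matrix.vecCons v (fun _ : Fin 1 => w) = ![v, w] := by
    ext i; fin_cases i <;> rfl
  rw [← e]
  rfl

theorem toBilin_swap (η : E [⋀^Fin 2]→L[ℝ] ℂ) (v w : E) : toBilin η v w = -toBilin η w v := by
  simp only [toBilin_apply]
  have h := η.toAlternatingMap.map_swap ![w, v] (i := 0) (j := 1) (by decide)
  have e : ![w, v] ∘ Equiv.swap (0 : Fin 2) 1 = ![v, w] := by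
    ext i; fin_cases i <;> simp
  rw [e] at h
  exact h

theorem toBilin_compContinuousLinearMap (η : E [⋀^Fin 2]→L[ℝ] ℂ) (P : E →L[ℝ] E) (v w : E) :
    toBilin (η.compContinuousLinearMap P) v w = toBilin η (P v) (P w) := by
  simp only [toBilin_apply, ContinuousAlternatingMap.compContinuousLinearMap_apply]
  congr 1
  ext i; fin_cases i <;> rfl

/-- The invariant formula for the exterior derivative of a 2-form. -/
theorem extDeriv_two_apply_vectorField {η : E → E [⋀^Fin 2]→L[ℝ] ℂ} {x : E} {A B C : E → E}
    (hη : DifferentiableAt ℝ η x) (hA : DifferentiableAt ℝ A x) (hB : DifferentiableAt ℝ B x)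
    (hC : DifferentiableAt ℝ C x) :
    extDeriv η x ![A x, B x, C x] =
      fderiv ℝ (fun y => toBilin (η y) (B y) (C y)) x (A x)
      - fderiv ℝ (fun y => toBilin (η y) (A y) (C y)) x (B x)
      + fderiv ℝ (fun y => toBilin (η y) (A y) (B y)) x (C x)
      - toBilin (η x) (VectorField.lieBracket ℝ A B x) (C x)
      + toBilin (η x) (VectorField.lieBracket ℝ A C x) (B x)
      - toBilin (η x) (VectorField.lieBracket ℝ B C x) (A x) := by
  have h := extDeriv_apply_vectorField (V := ![A, B, C]) hη
    (by intro i; fin_cases i <;> assumption)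
  have e : (fun i => (![A, B, C] : Fin 3 → E → E) i x) = ![A x, B x, C x] := by
    ext i; fin_cases i <;> rfl
  rw [e] at h
  rw [h]
  simp only [toBilin_apply]
  have e0 : ∀ y, (0 : Fin 3).removeNth (fun i => (![A, B, C] : Fin 3 → E → E) i y)
      = ![B y, C y] := by
    intro y; ext i; fin_cases i <;> rfl
  have e1 : ∀ y, (1 : Fin 3).removeNth (fun i => (![A, B, C] : Fin 3 → E → E) i y)
      = ![A y, C y] := by
    intro y; ext i; fin_cases i <;> rfl
  have e2 : ∀ y, (2 : Fin 3).removeNth (fun i => (![A, B, C] : Fin 3 → E → E) i y)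
      = ![A y, B y] := by
    intro y; ext i; fin_cases i <;> rfl
  have g0 : ∀ f : Fin 2 → ℂ, ∑ j ≥ (0 : Fin 2), f j = f 0 + f 1 := fun f => by
    rw [show Finset.Ici (0 : Fin 2) = {0, 1} by decide]
    simp
  have g1 : ∀ f : Fin 2 → ℂ, ∑ j ≥ (1 : Fin 2), f j = f 1 := fun f => by
    rw [show Finset.Ici (1 : Fin 2) = {1} by decide]
    simp
  have r0 : (0 : Fin 2).removeNth ((0 : Fin 3).removeNth ![A x, B x, C x]) = ![C x] := by
    ext i; fin_cases i; rfl
  have r1 : (1 : Fin 2).removeNth ((0 : Fin 3).removeNth ![A x, B x, C x]) = ![B x] := by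
    ext i; fin_cases i; rfl
  have r2 : (1 : Fin 2).removeNth ((1 : Fin 3).removeNth ![A x, B x, C x]) = ![A x] := by
    ext i; fin_cases i; rfl
  rw [Fin.sum_univ_three, Fin.sum_univ_two, g0, g1]
  simp only [e0, e1, e2, Fin.castSucc_zero, Fin.castSucc_one, r0, r1, r2]
  simp
  ring

end Bilin

/-! ### Linear algebra of the horizontal lift at a point -/

section Pointwise

variable {E : Type*} [NormedAddCommGroup E] [NormedSpace ℂ E]
  {F : Type*} [NormedAddCommGroup F] [NormedSpace ℂ F]

/-- The linear model of a relative Kähler fibration at a point: `Q` is the differential of the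
projection and `η` is a real `(1,1)`-form which is positive on `ker Q`. -/
structure IsPosOnKer (Q : E →L[ℝ] F) (η : E [⋀^Fin 2]→L[ℝ] ℂ) : Prop where
  surj : Function.Surjective Q
  map_I : ∀ v, Q (Complex.I • v) = Complex.I • Q v
  real : ∀ v w, (toBilin η v w).im = 0
  type_one_one : ∀ v w, toBilin η (Complex.I • v) (Complex.I • w) = toBilin η v w
  pos : ∀ v, Q v = 0 → v ≠ 0 → 0 < (toBilin η v (Complex.I • v)).re

/-- `L` lifts vectors of the base to vectors orthogonal to `ker Q` with respect to `η`. -/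
def IsLift (Q : E →L[ℝ] F) (η : E [⋀^Fin 2]→L[ℝ] ℂ) (L : F →L[ℝ] E) : Prop :=
  ∀ u, Q (L u) = u ∧ ∀ w, Q w = 0 → toBilin η (L u) w = 0

open Classical in
/-- The real horizontal lift defined by `Q` and `η`, as a linear map (zero if there is none). -/
noncomputable def realLift (Q : E →L[ℝ] F) (η : E [⋀^Fin 2]→L[ℝ] ℂ) : F →L[ℝ] E :=
  if h : ∃ L, IsLift Q η L then h.choose else 0

/-- The projection onto `ker Q` along the horizontal space. -/
noncomputable def vertProj (Q : E →L[ℝ] F) (η : E [⋀^Fin 2]→L[ℝ] ℂ) : E →L[ℝ] E :=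
  ContinuousLinearMap.id ℝ E - realLift Q η ∘L Q

theorem vertProj_of_map_eq_zero {Q : E →L[ℝ] F} {η : E [⋀^Fin 2]→L[ℝ] ℂ} {v : E}
    (hv : Q v = 0) : vertProj Q η v = v := by
  simp [vertProj, hv]

namespace IsPosOnKer

variable {Q : E →L[ℝ] F} {η : E [⋀^Fin 2]→L[ℝ] ℂ}

/-- A positive form of type `(1,1)` is nondegenerate. -/
theorem eq_zero (h : IsPosOnKer Q η) {v : E} (hv : Q v = 0)
    (hw : ∀ w, Q w = 0 → toBilin η v w = 0) : v = 0 := by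
  by_contra hne
  have h1 := h.pos v hv hne
  rw [hw _ (by rw [h.map_I, hv, smul_zero])] at h1
  simp at h1

theorem eq_of_lift (h : IsPosOnKer Q η) {v v' : E} (hv : Q v = Q v')
    (hw : ∀ w, Q w = 0 → toBilin η v w = 0) (hw' : ∀ w, Q w = 0 → toBilin η v' w = 0) :
    v = v' := by
  rw [← sub_eq_zero]
  refine h.eq_zero (by simp [hv]) fun w hQ => ?_
  simp [hw w hQ, hw' w hQ]

variable [FiniteDimensional ℂ E] [FiniteDimensional ℂ F]

/-- Since `η` is nondegenerate on `ker Q`, every vector differs from a horizontal one by an element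
of `ker Q`. -/
theorem exists_isLift (h : IsPosOnKer Q η) : ∃ L, IsLift Q η L := by
  have : FiniteDimensional ℝ E := FiniteDimensional.complexToReal E
  have : FiniteDimensional ℝ F := FiniteDimensional.complexToReal F
  obtain ⟨s, hs⟩ := Q.exists_rightInverse_of_surjective (LinearMap.range_eq_top.2 h.surj)
  let K : Submodule ℝ E := LinearMap.ker (Q : E →ₗ[ℝ] F)
  -- the real part of `η` as a map from `E` to the dual of `ker Q`
  let D : E →ₗ[ℝ] Module.Dual ℝ K :=
    { toFun := fun v => Complex.reLm ∘ₗ (toBilin η v : E →ₗ[ℝ] ℂ) ∘ₗ K.subtype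
      map_add' := fun v w => by ext; simp
      map_smul' := fun c v => by ext; simp }
  have hD : ∀ v w, ∀ hw : w ∈ K, D v ⟨w, hw⟩ = (toBilin η v w).re := fun v w hw => rfl
  have hinj : Function.Injective (D ∘ₗ K.subtype) := by
    rw [← LinearMap.ker_eq_bot, LinearMap.ker_eq_bot']
    rintro ⟨v, hv⟩ h0
    ext
    refine h.eq_zero hv fun w hw => ?_
    have := congrArg (fun f : Module.Dual ℝ K => f ⟨w, hw⟩) h0
    exact Complex.ext this (h.real v w)
  have hsurj : Function.Surjective (D ∘ₗ K.subtype) :=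
    (LinearMap.injective_iff_surjective_of_finrank_eq_finrank
      Subspace.dual_finrank_eq.symm).1 hinj
  let e : K ≃ₗ[ℝ] Module.Dual ℝ K := LinearEquiv.ofBijective _ ⟨hinj, hsurj⟩
  let s' : F →ₗ[ℝ] E := s
  -- subtract from a right inverse of `Q` the vertical vector with the same pairing with `ker Q`
  let L : F →ₗ[ℝ] E := s' - K.subtype ∘ₗ (e.symm : Module.Dual ℝ K →ₗ[ℝ] K) ∘ₗ D ∘ₗ s'
  refine ⟨LinearMap.toContinuousLinearMap L, fun u => ⟨?_, fun w hw => ?_⟩⟩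
  · have h1 : Q (s u) = u := congrArg (fun f : F →L[ℝ] F => f u) hs
    have h2 : Q (e.symm (D (s u)) : E) = 0 := (e.symm (D (s u))).2
    simp [L, s', h1, h2]
  · have h1 : D (e.symm (D (s u)) : E) = D (s u) := e.apply_symm_apply (D (s u))
    refine Complex.ext ?_ (h.real _ _)
    have h2 : D (L u) = 0 := by
      simp [L, s', h1]
    exact congrArg (fun f : Module.Dual ℝ K => f ⟨w, hw⟩) h2

/-- The chosen lift is the only one, by `eq_realLift` below. -/
theorem isLift_realLift (h : IsPosOnKer Q η) : IsLift Q η (realLift Q η) := by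
  rw [realLift, dif_pos h.exists_isLift]
  exact h.exists_isLift.choose_spec

theorem map_realLift (h : IsPosOnKer Q η) (u : F) : Q (realLift Q η u) = u :=
  (h.isLift_realLift u).1

theorem toBilin_realLift (h : IsPosOnKer Q η) (u : F) {w : E} (hw : Q w = 0) :
    toBilin η (realLift Q η u) w = 0 :=
  (h.isLift_realLift u).2 w hw

theorem eq_realLift (h : IsPosOnKer Q η) {u : F} {v : E} (hv : Q v = u)
    (hw : ∀ w, Q w = 0 → toBilin η v w = 0) : v = realLift Q η u :=
  h.eq_of_lift (hv.trans (h.map_realLift u).symm) hw fun _ => h.toBilin_realLift u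

/-- The orthogonal of `ker Q` is a complex subspace, because `η` is of type `(1,1)`. -/
theorem realLift_I (h : IsPosOnKer Q η) (u : F) :
    realLift Q η (Complex.I • u) = Complex.I • realLift Q η u := by
  refine (h.eq_realLift (by rw [h.map_I, h.map_realLift]) fun w hw => ?_).symm
  have h1 := h.type_one_one (realLift Q η u) (-(Complex.I • w))
  have h2 : Complex.I • (-(Complex.I • w)) = w := by
    rw [smul_neg, smul_smul, Complex.I_mul_I, neg_one_smul, neg_neg]
  rw [h2] at h1
  rw [h1, h.toBilin_realLift]
  rw [map_neg, h.map_I, hw, smul_zero, neg_zero]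

theorem map_vertProj (h : IsPosOnKer Q η) (v : E) : Q (vertProj Q η v) = 0 := by
  simp [vertProj, h.map_realLift]

theorem vertProj_realLift (h : IsPosOnKer Q η) (u : F) : vertProj Q η (realLift Q η u) = 0 := by
  simp [vertProj, h.map_realLift]

/-- The part of `η` living on vertical vectors is `η` minus its part living on horizontal ones. -/
theorem toBilin_vertProj (h : IsPosOnKer Q η) (v w : E) :
    toBilin η (vertProj Q η v) (vertProj Q η w) =
      toBilin η v w - toBilin η (realLift Q η (Q v)) (realLift Q η (Q w)) := by
  have h1 := h.toBilin_realLift (Q v) (h.map_vertProj w)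
  have h2 := h.toBilin_realLift (Q w) (h.map_vertProj v)
  rw [toBilin_swap, neg_eq_zero] at h2
  simp only [vertProj, sub_apply, ContinuousLinearMap.id_apply,
    ContinuousLinearMap.comp_apply, map_sub] at h1 h2 ⊢
  linear_combination (-1 : ℂ) * h1 - h2

end IsPosOnKer

end Pointwise

/-! ### Smooth dependence of the horizontal lift -/

section Smoothness

variable {E : Type*} [NormedAddCommGroup E] [NormedSpace ℂ E]
  {F : Type*} [NormedAddCommGroup F] [NormedSpace ℂ F] [FiniteDimensional ℂ F]
  {G : Type*} [NormedAddCommGroup G] [NormedSpace ℝ G] {n : ℕ∞ω}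

theorem contDiffAt_clm_inverse {H : Type*} [NormedAddCommGroup H] [NormedSpace ℝ H]
    [CompleteSpace H] {A : G → H →L[ℝ] H} {x : G} (hA : ContDiffAt ℝ n A x)
    (hx : A x = ContinuousLinearMap.id ℝ H) :
    ContDiffAt ℝ n (fun y => (A y).inverse) x ∧
      ∀ᶠ y in 𝓝 x, (A y).IsInvertible := by
  have h : A x = (ContinuousLinearEquiv.refl ℝ H : H →L[ℝ] H) := hx
  constructor
  · have h1 := contDiffAt_map_inverse (𝕜 := ℝ) (n := n) (ContinuousLinearEquiv.refl ℝ H)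
    rw [← h] at h1
    exact h1.comp x hA
  · have h1 := (ContinuousLinearEquiv.refl ℝ H).nhds
    rw [← h] at h1
    exact hA.continuousAt h1

/-- Near a point where `Q` is onto there is a family of projections onto `ker Q` which depends on
the point as smoothly as `Q` does. -/
theorem exists_contDiffAt_proj_ker {Q : G → E →L[ℝ] F} {x : G} (hQ : ContDiffAt ℝ n Q x)
    (hx : Function.Surjective (Q x)) :
    ∃ R : G → E →L[ℝ] E, ContDiffAt ℝ n R x ∧
      ∀ᶠ y in 𝓝 x, (∀ v, Q y (R y v) = 0) ∧ ∀ v, Q y v = 0 → R y v = v := by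
  have : FiniteDimensional ℝ F := FiniteDimensional.complexToReal F
  have : CompleteSpace F := FiniteDimensional.complete ℝ F
  obtain ⟨s, hs⟩ := (Q x).exists_rightInverse_of_surjective (LinearMap.range_eq_top.2 hx)
  have hQs : ContDiffAt ℝ n (fun y => Q y ∘L s) x := hQ.clm_comp contDiffAt_const
  obtain ⟨hinv, hev⟩ := contDiffAt_clm_inverse hQs hs
  refine ⟨fun y => ContinuousLinearMap.id ℝ E - (s ∘L (Q y ∘L s).inverse) ∘L Q y,
    contDiffAt_const.sub ((contDiffAt_const.clm_comp hinv).clm_comp hQ), ?_⟩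
  filter_upwards [hev] with y hy
  refine ⟨fun v => ?_, fun v hv => by simp [hv]⟩
  obtain ⟨e, he⟩ := hy
  have h1 : Q y (s ((Q y ∘L s).inverse (Q y v))) = Q y v := by
    rw [← he, ContinuousLinearMap.inverse_equiv]
    have h2 := congrArg (fun f : F →L[ℝ] F => f (e.symm (Q y v))) he
    simp only [ContinuousLinearMap.comp_apply, ContinuousLinearEquiv.coe_coe,
      ContinuousLinearEquiv.apply_symm_apply] at h2
    exact h2.symm
  simp [h1]

/-- The lift of `u` is the unique solution of an overdetermined linear system which depends
smoothly on the point, so it is obtained by applying the inverse of a smooth family of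
endomorphisms. -/
theorem contDiffAt_realLift [FiniteDimensional ℂ E] {Q : G → E →L[ℝ] F}
    {η : G → E [⋀^Fin 2]→L[ℝ] ℂ} {x : G}
    (hQ : ContDiffAt ℝ n Q x) (hη : ContDiffAt ℝ n η x)
    (h : ∀ᶠ y in 𝓝 x, IsPosOnKer (Q y) (η y)) :
    ContDiffAt ℝ n (fun y => realLift (Q y) (η y)) x := by
  have : FiniteDimensional ℝ E := FiniteDimensional.complexToReal E
  have : FiniteDimensional ℝ F := FiniteDimensional.complexToReal F
  have : CompleteSpace E := FiniteDimensional.complete ℝ E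
  have hx := h.self_of_nhds
  obtain ⟨R, hR, hRev⟩ := exists_contDiffAt_proj_ker hQ hx.surj
  -- the linear system: `A y v = (u, 0)` means that `v` is a horizontal vector over `u`
  let A : G → E →L[ℝ] F × (E →L[ℝ] ℂ) := fun y =>
    (Q y).prod ((ContinuousLinearMap.compL ℝ E E ℂ).flip (R y) ∘L toBilin (η y))
  have hAapply : ∀ y v, A y v = (Q y v, (toBilin (η y) v) ∘L R y) := fun y v => rfl
  have hA : ContDiffAt ℝ n A x := by
    have h1 : ContDiffAt ℝ n (fun y => (ContinuousLinearMap.compL ℝ E E ℂ).flip (R y)) x :=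
      (ContinuousLinearMap.contDiff _).contDiffAt.comp x hR
    have h2 : ContDiffAt ℝ n (fun y => toBilin (η y)) x :=
      contDiff_toBilin.contDiffAt.comp x hη
    have h3 := h1.clm_comp h2
    have h4 : A = fun y => (ContinuousLinearMap.inl ℝ F (E →L[ℝ] ℂ)) ∘L Q y
        + (ContinuousLinearMap.inr ℝ F (E →L[ℝ] ℂ)) ∘L
          ((ContinuousLinearMap.compL ℝ E E ℂ).flip (R y) ∘L toBilin (η y)) := by
      funext y
      ext v <;> simp [A]
    rw [h4]
    exact (contDiffAt_const.clm_comp hQ).add (contDiffAt_const.clm_comp h3)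
  have hinj : LinearMap.ker (A x : E →ₗ[ℝ] F × (E →L[ℝ] ℂ)) = ⊥ := by
    refine LinearMap.ker_eq_bot'.2 fun v hv => ?_
    have hv' : A x v = 0 := hv
    rw [hAapply, Prod.mk_eq_zero] at hv'
    refine hx.eq_zero hv'.1 fun w hw => ?_
    have h1 := congrArg (fun f : E →L[ℝ] ℂ => f w) hv'.2
    simpa [hRev.self_of_nhds.2 w hw] using h1
  obtain ⟨l, hl⟩ := LinearMap.exists_leftInverse_of_injective
    (A x : E →ₗ[ℝ] F × (E →L[ℝ] ℂ)) hinj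
  let ℓ : F × (E →L[ℝ] ℂ) →L[ℝ] E := LinearMap.toContinuousLinearMap l
  have hℓ : ℓ ∘L A x = ContinuousLinearMap.id ℝ E := by
    ext v
    exact congrArg (fun f : E →ₗ[ℝ] E => f v) hl
  have hℓA : ContDiffAt ℝ n (fun y => ℓ ∘L A y) x := contDiffAt_const.clm_comp hA
  obtain ⟨hinv, hev⟩ := contDiffAt_clm_inverse hℓA hℓ
  have key : (fun y => realLift (Q y) (η y)) =ᶠ[𝓝 x] fun y =>
      (ℓ ∘L A y).inverse ∘L (ℓ ∘L ContinuousLinearMap.inl ℝ F (E →L[ℝ] ℂ)) := by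
    filter_upwards [hev, h, hRev] with y hy hpos hRy
    obtain ⟨e, he⟩ := hy
    ext u
    have h1 : A y (realLift (Q y) (η y) u) = (u, 0) := by
      rw [hAapply, hpos.map_realLift]
      congr 1
      ext w
      exact hpos.toBilin_realLift u (hRy.1 w)
    have h2 : e (realLift (Q y) (η y) u) = ℓ (u, 0) := by
      rw [← h1]
      exact congrArg (fun f : E →L[ℝ] E => f (realLift (Q y) (η y) u)) he
    rw [← he, ContinuousLinearMap.inverse_equiv]
    simp [← h2]
  exact (hinv.clm_comp contDiffAt_const).congr_of_eventuallyEq key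

end Smoothness

/-! ### Brackets of horizontal lifts in a chart -/

section Local

open VectorField

variable {E : Type*} [NormedAddCommGroup E] [NormedSpace ℂ E]
  {F : Type*} [NormedAddCommGroup F] [NormedSpace ℂ F]

/-- The vector field `A` is differentiable at `x`, and near `x` the map `q` sends it to the constant
vector `u`. -/
def ProjectsTo (q : E → F) (x : E) (A : E → E) (u : F) : Prop :=
  DifferentiableAt ℝ A x ∧ ∀ᶠ y in 𝓝 x, fderiv ℝ q y (A y) = u

/-- The bracket of two fields lying over constant fields is vertical, as constant fields commute. -/
theorem ProjectsTo.fderiv_lieBracket {q : E → F} {x : E} {A B : E → E} {u v : F}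
    (hq : ContDiffAt ℝ ∞ q x) (hA : ProjectsTo q x A u) (hB : ProjectsTo q x B v) :
    fderiv ℝ q x (lieBracket ℝ A B x) = 0 := by
  have h : minSmoothness ℝ 2 ≤ (∞ : ℕ∞ω) := by
    simp only [minSmoothness_of_isRCLikeNormedField]
    exact WithTop.coe_le_coe.2 le_top
  have hu : (fun y => fderiv ℝ q y (A y)) =ᶠ[𝓝 x] fun _ => u := hA.2
  have hv : (fun y => fderiv ℝ q y (B y)) =ᶠ[𝓝 x] fun _ => v := hB.2
  rw [fderiv_apply_lieBracket hq h hB.1 hA.1, hu.fderiv_eq, hv.fderiv_eq]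
  simp

/-- A relative Kähler fibration near a point `x` in a chart of the total space: `q` is the
projection in coordinates of the base, and `η` represents the form. -/
structure IsLocalFibration (q : E → F) (η : E → E [⋀^Fin 2]→L[ℝ] ℂ) (x : E) : Prop where
  contDiffAt_proj : ContDiffAt ℝ ∞ q x
  contDiffAt_form : ContDiffAt ℝ ∞ η x
  closed : extDeriv η x = 0
  pos : ∀ᶠ y in 𝓝 x, IsPosOnKer (fderiv ℝ q y) (η y)

/-- The horizontal lift of the constant vector field `u`. -/
noncomputable def liftField (q : E → F) (η : E → E [⋀^Fin 2]→L[ℝ] ℂ) (u : F) (y : E) : E :=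
  realLift (fderiv ℝ q y) (η y) u

namespace IsLocalFibration

variable {q : E → F} {η : E → E [⋀^Fin 2]→L[ℝ] ℂ} {x : E}

theorem contDiffAt_fderiv (h : IsLocalFibration q η x) : ContDiffAt ℝ ∞ (fderiv ℝ q) x :=
  h.contDiffAt_proj.fderiv_right (m := ∞) le_rfl

theorem differentiableAt_form (h : IsLocalFibration q η x) : DifferentiableAt ℝ η x :=
  h.contDiffAt_form.differentiableAt (by simp)

variable [FiniteDimensional ℂ E] [FiniteDimensional ℂ F]

theorem contDiffAt_realLift (h : IsLocalFibration q η x) :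
    ContDiffAt ℝ ∞ (fun y => realLift (fderiv ℝ q y) (η y)) x :=
  _root_.contDiffAt_realLift h.contDiffAt_fderiv h.contDiffAt_form h.pos

theorem contDiffAt_liftField (h : IsLocalFibration q η x) (u : F) :
    ContDiffAt ℝ ∞ (liftField q η u) x :=
  h.contDiffAt_realLift.clm_apply contDiffAt_const

theorem contDiffAt_vertProj (h : IsLocalFibration q η x) :
    ContDiffAt ℝ ∞ (fun y => vertProj (fderiv ℝ q y) (η y)) x :=
  contDiffAt_const.sub (h.contDiffAt_realLift.clm_comp h.contDiffAt_fderiv)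

theorem projectsTo_liftField (h : IsLocalFibration q η x) (u : F) :
    ProjectsTo q x (liftField q η u) u :=
  ⟨(h.contDiffAt_liftField u).differentiableAt (by simp), h.pos.mono fun _ hy => hy.map_realLift u⟩

theorem projectsTo_vertProj (h : IsLocalFibration q η x) (w : E) :
    ProjectsTo q x (fun y => vertProj (fderiv ℝ q y) (η y) w) 0 :=
  ⟨(h.contDiffAt_vertProj.clm_apply contDiffAt_const).differentiableAt (by simp),
    h.pos.mono fun _ hy => hy.map_vertProj w⟩

theorem fderiv_lieBracket_liftField (h : IsLocalFibration q η x) (u v : F) :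
    fderiv ℝ q x (lieBracket ℝ (liftField q η u) (liftField q η v) x) = 0 :=
  (h.projectsTo_liftField u).fderiv_lieBracket h.contDiffAt_proj (h.projectsTo_liftField v)

theorem toBilin_liftField (h : IsLocalFibration q η x) (u : F) {w : E}
    (hw : fderiv ℝ q x w = 0) : toBilin (η x) (liftField q η u x) w = 0 :=
  h.pos.self_of_nhds.toBilin_realLift u hw

/-- Closedness of the form gives the contraction of the bracket of two horizontal lifts with a
vertical vector: in the invariant formula for the exterior derivative every other term vanishes,
as horizontal and vertical vectors are orthogonal and the bracket of a horizontal lift with a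
vertical field is vertical. -/
theorem toBilin_lieBracket_liftField (h : IsLocalFibration q η x) (u v : F) {w : E}
    (hw : fderiv ℝ q x w = 0) :
    toBilin (η x) (lieBracket ℝ (liftField q η u) (liftField q η v) x) w =
      fderiv ℝ (fun y => toBilin (η y) (liftField q η u y) (liftField q η v y)) x w := by
  let W : E → E := fun y => vertProj (fderiv ℝ q y) (η y) w
  have hu := h.projectsTo_liftField u
  have hv := h.projectsTo_liftField v
  have hW : ProjectsTo q x W 0 := h.projectsTo_vertProj w
  have hWx : W x = w := vertProj_of_map_eq_zero hw
  have horth : ∀ u, (fun y => toBilin (η y) (liftField q η u y) (W y)) =ᶠ[𝓝 x] fun _ => 0 :=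
    fun u => h.pos.mono fun y hy => hy.toBilin_realLift u (hy.map_vertProj w)
  have key := extDeriv_two_apply_vectorField h.differentiableAt_form hu.1 hv.1 hW.1
  rw [h.closed, (horth u).fderiv_eq, (horth v).fderiv_eq,
    toBilin_swap _ (lieBracket ℝ (liftField q η u) W x),
    toBilin_swap _ (lieBracket ℝ (liftField q η v) W x),
    h.toBilin_liftField v (hu.fderiv_lieBracket h.contDiffAt_proj hW),
    h.toBilin_liftField u (hv.fderiv_lieBracket h.contDiffAt_proj hW), hWx] at key
  simp at key
  linear_combination key

theorem differentiableAt_vertForm (h : IsLocalFibration q η x) :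
    DifferentiableAt ℝ (fun y => (η y).compContinuousLinearMap (vertProj (fderiv ℝ q y) (η y))) x :=
  h.differentiableAt_form.continuousAlternatingMapCompContinuousLinearMap
    (h.contDiffAt_vertProj.differentiableAt (by simp))

end IsLocalFibration

/-- An alternating 3-form vanishes if it vanishes on all triples of vectors adapted to a splitting
`v = H v + P v`. -/
theorem alternating_three_eq_zero {τ : E [⋀^Fin 3]→L[ℝ] ℂ} {H P : E → E}
    (hHP : ∀ v, H v + P v = v)
    (hHHH : ∀ a b c, τ ![H a, H b, H c] = 0) (hHHP : ∀ a b c, τ ![H a, H b, P c] = 0)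
    (hPP : ∀ a b c, τ ![a, P b, P c] = 0) : τ = 0 := by
  have s01 : ∀ a b c, τ ![b, a, c] = -τ ![a, b, c] := fun a b c => by
    have h := τ.toAlternatingMap.map_swap ![a, b, c] (i := 0) (j := 1) (by decide)
    have e : ![a, b, c] ∘ Equiv.swap (0 : Fin 3) 1 = ![b, a, c] := by
      ext i; fin_cases i <;> rfl
    rwa [e] at h
  have s12 : ∀ a b c, τ ![a, c, b] = -τ ![a, b, c] := fun a b c => by
    have h := τ.toAlternatingMap.map_swap ![a, b, c] (i := 1) (j := 2) (by decide)
    have e : ![a, b, c] ∘ Equiv.swap (1 : Fin 3) 2 = ![a, c, b] := by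
      ext i; fin_cases i <;> rfl
    rwa [e] at h
  have add0 : ∀ a a' b c, τ ![a + a', b, c] = τ ![a, b, c] + τ ![a', b, c] := fun a a' b c =>
    τ.toAlternatingMap.map_vecCons_add _ _ _
  have add1 : ∀ a b b' c, τ ![a, b + b', c] = τ ![a, b, c] + τ ![a, b', c] := fun a b b' c => by
    rw [s01, add0, s01 a b, s01 a b']; ring
  have add2 : ∀ a b c c', τ ![a, b, c + c'] = τ ![a, b, c] + τ ![a, b, c'] := fun a b c c' => by
    rw [s12, add1, s12 a b c, s12 a b c']; ring
  ext v
  have e : v = ![H (v 0) + P (v 0), H (v 1) + P (v 1), H (v 2) + P (v 2)] := by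
    ext i; fin_cases i <;> simp [hHP]
  have h1 := hHHH (v 0) (v 1) (v 2)
  have h2 := hHHP (v 0) (v 1) (v 2)
  have h3 : τ ![H (v 0), P (v 1), H (v 2)] = 0 := by rw [s12, hHHP, neg_zero]
  have h4 := hPP (H (v 0)) (v 1) (v 2)
  have h5 : τ ![P (v 0), H (v 1), H (v 2)] = 0 := by rw [s01, s12, hHHP, neg_zero, neg_zero]
  have h6 : τ ![P (v 0), H (v 1), P (v 2)] = 0 := by rw [s01, hPP, neg_zero]
  have h7 : τ ![P (v 0), P (v 1), H (v 2)] = 0 := by rw [s12, s01, hPP, neg_zero, neg_zero]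
  have h8 := hPP (P (v 0)) (v 1) (v 2)
  rw [e]
  simp only [add0, add1, add2, h1, h2, h3, h4, h5, h6, h7, h8]
  simp

namespace IsLocalFibration

variable {q : E → F} {η : E → E [⋀^Fin 2]→L[ℝ] ℂ} {x : E}
  [FiniteDimensional ℂ E] [FiniteDimensional ℂ F]

/-- The part of `η` living on vertical vectors is closed if and only if the horizontal lifts of
constant vector fields commute. Its differential vanishes on three horizontal vectors, it is given
by these brackets on two horizontal vectors and a vertical one, and it agrees with `dη` as soon as
two vectors are vertical. -/
theorem extDeriv_vertForm_eq_zero_iff (h : IsLocalFibration q η x) :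
    extDeriv (fun y => (η y).compContinuousLinearMap (vertProj (fderiv ℝ q y) (η y))) x = 0 ↔
      ∀ u v, lieBracket ℝ (liftField q η u) (liftField q η v) x = 0 := by
  set ρ : E → E [⋀^Fin 2]→L[ℝ] ℂ :=
    fun y => (η y).compContinuousLinearMap (vertProj (fderiv ℝ q y) (η y))
  have hρ : DifferentiableAt ℝ ρ x := h.differentiableAt_vertForm
  have hpos := h.pos.self_of_nhds
  let H : F → E → E := liftField q η
  let W : E → E → E := fun w y => vertProj (fderiv ℝ q y) (η y) w
  have hH : ∀ u, ProjectsTo q x (H u) u := h.projectsTo_liftField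
  have hW : ∀ w, ProjectsTo q x (W w) 0 := h.projectsTo_vertProj
  have hρapply : ∀ y v w, toBilin (ρ y) v w = toBilin (η y) (vertProj (fderiv ℝ q y) (η y) v)
      (vertProj (fderiv ℝ q y) (η y) w) := fun y v w => toBilin_compContinuousLinearMap _ _ _ _
  have hρH : ∀ u v, toBilin (ρ x) (H u x) v = 0 := fun u v => by
    rw [hρapply, show H u x = realLift _ _ u from rfl, hpos.vertProj_realLift]
    simp
  have hρH' : ∀ u v, toBilin (ρ x) v (H u x) = 0 := fun u v => by
    rw [toBilin_swap, hρH, neg_zero]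
  have hρHev : ∀ u (B : E → E), (fun y => toBilin (ρ y) (H u y) (B y)) =ᶠ[𝓝 x] fun _ => 0 :=
    fun u B => h.pos.mono fun y hy => by
      simp only [hρapply]
      rw [show H u y = realLift _ _ u from rfl, hy.vertProj_realLift]
      simp
  have hHHW : ∀ u v w, extDeriv ρ x ![H u x, H v x, W w x] =
      -toBilin (η x) (lieBracket ℝ (H u) (H v) x) (W w x) := fun u v w => by
    rw [extDeriv_two_apply_vectorField hρ (hH u).1 (hH v).1 (hW w).1, (hρHev u _).fderiv_eq,
      (hρHev u _).fderiv_eq, (hρHev v _).fderiv_eq, hρH', hρH', hρapply,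
      vertProj_of_map_eq_zero (h.fderiv_lieBracket_liftField u v),
      vertProj_of_map_eq_zero (hpos.map_vertProj w)]
    simp [H, W]
  have hHHH : ∀ u v w, extDeriv ρ x ![H u x, H v x, H w x] = 0 := fun u v w => by
    rw [extDeriv_two_apply_vectorField hρ (hH u).1 (hH v).1 (hH w).1, (hρHev u _).fderiv_eq,
      (hρHev u _).fderiv_eq, (hρHev v _).fderiv_eq, hρH', hρH', hρH']
    simp
  -- `ρ` and `η` agree as soon as one entry is vertical, and every term of the invariant formula
  -- with two vertical fields has a vertical entry, so the formula gives one value for both forms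
  have hWW : ∀ a b c, extDeriv ρ x ![a, W b x, W c x] = 0 := fun a b c => by
    let A : E → E := fun y => H (fderiv ℝ q x a) y + W a y
    have hA : ProjectsTo q x A (fderiv ℝ q x a) :=
      ⟨(hH _).1.add (hW a).1, by
        filter_upwards [(hH (fderiv ℝ q x a)).2, (hW a).2] with y h1 h2
        simp [A, h1, h2]⟩
    have hAx : A x = a := by
      simp [A, H, W, liftField, vertProj]
    have hg : ∀ y v w, fderiv ℝ q y w = 0 → IsPosOnKer (fderiv ℝ q y) (η y) →
        toBilin (ρ y) v w = toBilin (η y) v w := fun y v w hw hy => by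
      rw [hρapply, hy.toBilin_vertProj, hw]
      simp
    have hg' : ∀ y v w, fderiv ℝ q y w = 0 → IsPosOnKer (fderiv ℝ q y) (η y) →
        toBilin (ρ y) w v = toBilin (η y) w v := fun y v w hw hy => by
      rw [toBilin_swap, hg y v w hw hy, ← toBilin_swap]
    have hgev : ∀ w (B : E → E), (fun y => toBilin (ρ y) (B y) (W w y)) =ᶠ[𝓝 x]
        fun y => toBilin (η y) (B y) (W w y) := fun w B => h.pos.mono fun y hy =>
      hg y _ _ (hy.map_vertProj w) hy
    have key := extDeriv_two_apply_vectorField h.differentiableAt_form hA.1 (hW b).1 (hW c).1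
    rw [← hAx, extDeriv_two_apply_vectorField hρ hA.1 (hW b).1 (hW c).1, (hgev c _).fderiv_eq,
      (hgev c _).fderiv_eq, (hgev b _).fderiv_eq, hg x _ _ (hpos.map_vertProj c) hpos,
      hg x _ _ (hpos.map_vertProj b) hpos,
      hg' x _ _ ((hW b).fderiv_lieBracket h.contDiffAt_proj (hW c)) hpos, ← key, h.closed]
    rfl
  constructor
  · intro h0 u v
    refine hpos.eq_zero (h.fderiv_lieBracket_liftField u v) fun w hw => ?_
    have h1 := hHHW u v w
    rw [h0, show W w x = w from vertProj_of_map_eq_zero hw] at h1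
    simpa using h1
  · intro h0
    refine alternating_three_eq_zero (H := fun v => H (fderiv ℝ q x v) x) (P := fun v => W v x)
      ?_ (fun a b c => hHHH _ _ _) (fun a b c => ?_) hWW
    · intro v
      simp [H, W, liftField, vertProj]
    · rw [hHHW, show lieBracket ℝ (H _) (H _) x = 0 from h0 _ _]
      simp

end IsLocalFibration

end Local

/-! ### Exterior powers of a 2-form -/

section WedgePow

variable {V : Type*} [AddCommGroup V] [Module ℝ V] [TopologicalSpace V] {k : ℕ}

/-- Only one factor of `∏ i, η (v (2 i)) (v (2 i + 1))` involves a given entry of `v`. -/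
theorem exists_prod_pairs_update [DecidableEq (Fin (2 * k))] (η : V [⋀^Fin 2]→L[ℝ] ℂ)
    (v : Fin (2 * k) → V) (j : Fin (2 * k)) :
    ∃ (w : Fin 2 → V) (c : Fin 2) (C : ℂ), ∀ a : V,
      ∏ i : Fin k, η ![Function.update v j a ⟨2 * i, by omega⟩,
        Function.update v j a ⟨2 * i + 1, by omega⟩] = η (Function.update w c a) * C := by
  -- the entry `j` sits at the place `j % 2` of the factor `j / 2`
  let i₀ : Fin k := ⟨j / 2, by omega⟩
  refine ⟨![v ⟨2 * i₀, by omega⟩, v ⟨2 * i₀ + 1, by omega⟩], ⟨j % 2, by omega⟩,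
    ∏ i ∈ Finset.univ.erase i₀, η ![v ⟨2 * i, by omega⟩, v ⟨2 * i + 1, by omega⟩], fun a => ?_⟩
  rw [← Finset.mul_prod_erase _ _ (Finset.mem_univ i₀)]
  congr 1
  · congr 1
    ext c
    fin_cases c
    · by_cases h : (j : ℕ) % 2 = 0
      · have e : (⟨2 * i₀, by omega⟩ : Fin (2 * k)) = j := Fin.ext (by simp [i₀]; omega)
        have e' : (⟨(j : ℕ) % 2, by omega⟩ : Fin 2) = 0 := Fin.ext h
        simp [e, e']
      · have e : (⟨2 * i₀, by omega⟩ : Fin (2 * k)) ≠ j := by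
          intro e; have := congrArg Fin.val e; simp [i₀] at this; omega
        have e' : (⟨(j : ℕ) % 2, by omega⟩ : Fin 2) = 1 := Fin.ext (by simp; omega)
        simp [e, e']
    · by_cases h : (j : ℕ) % 2 = 0
      · have e : (⟨2 * i₀ + 1, by omega⟩ : Fin (2 * k)) ≠ j := by
          intro e; have := congrArg Fin.val e; simp [i₀] at this; omega
        have e' : (⟨(j : ℕ) % 2, by omega⟩ : Fin 2) = 0 := Fin.ext h
        simp [e, e']
      · have e : (⟨2 * i₀ + 1, by omega⟩ : Fin (2 * k)) = j := Fin.ext (by simp [i₀]; omega)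
        have e' : (⟨(j : ℕ) % 2, by omega⟩ : Fin 2) = 1 := Fin.ext (by simp; omega)
        simp [e, e']
  · refine Finset.prod_congr rfl fun i hi => ?_
    have hi' : (i : ℕ) ≠ j / 2 := fun h => Finset.ne_of_mem_erase hi (Fin.ext h)
    rw [Function.update_of_ne, Function.update_of_ne]
    · intro e; have := congrArg Fin.val e; simp at this; omega
    · intro e; have := congrArg Fin.val e; simp at this; omega

/-- The product `∏ i, η (v (2 i)) (v (2 i + 1))` as a multilinear map. The exterior power of `η` is
a multiple of its alternatization. -/
noncomputable def pairProd (η : V [⋀^Fin 2]→L[ℝ] ℂ) (k : ℕ) :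
    MultilinearMap ℝ (fun _ : Fin (2 * k) => V) ℂ where
  toFun v := ∏ i : Fin k, η ![v ⟨2 * i, by omega⟩, v ⟨2 * i + 1, by omega⟩]
  map_update_add' v j a a' := by
    obtain ⟨w, c, C, h⟩ := exists_prod_pairs_update η v j
    simp only [h, η.map_update_add, add_mul]
  map_update_smul' v j r a := by
    obtain ⟨w, c, C, h⟩ := exists_prod_pairs_update η v j
    simp only [h, η.map_update_smul, smul_mul_assoc]

/-- Up to a factor the exterior power is the alternatization of `pairProd η k`, so it is
alternating. -/
theorem wedgePow_eq_zero_of_linearDependent (η : V [⋀^Fin 2]→L[ℝ] ℂ) (k : ℕ)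
    {v : Fin (2 * k) → V} (hv : ¬LinearIndependent ℝ v) : wedgePow η k v = 0 := by
  have h := (MultilinearMap.alternatization (pairProd η k)).map_linearDependent v hv
  rw [MultilinearMap.alternatization_apply] at h
  rw [wedgePow, mul_eq_zero]
  right
  rw [← h]
  refine Finset.sum_congr rfl fun σ _ => ?_
  simp [pairProd, Units.smul_def]

theorem wedgePow_compContinuousLinearMap (η : V [⋀^Fin 2]→L[ℝ] ℂ) (P : V →L[ℝ] V) (k : ℕ)
    (v : Fin (2 * k) → V) :
    wedgePow (η.compContinuousLinearMap P) k v = wedgePow η k (fun i => P (v i)) := by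
  have h : ∀ a b : V, (η.compContinuousLinearMap P) ![a, b] = η ![P a, P b] := fun a b => by
    rw [ContinuousAlternatingMap.compContinuousLinearMap_apply]
    congr 1
    ext i; fin_cases i <;> rfl
  simp only [wedgePow, h]

end WedgePow

/-! ### Real bilinear maps invariant under multiplication by `i` -/

section Invariant

variable {F : Type*} [NormedAddCommGroup F] [NormedSpace ℂ F]
  {G : Type*} [AddCommGroup G] [Module ℝ G]

theorem bilin_I_left (f : F →ₗ[ℝ] F →ₗ[ℝ] G)
    (hf : ∀ u v, f (Complex.I • u) (Complex.I • v) = f u v) (u v : F) :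
    f (Complex.I • u) v = -f u (Complex.I • v) := by
  have h := hf u (-(Complex.I • v))
  rw [smul_neg, smul_smul, Complex.I_mul_I, neg_one_smul, neg_neg] at h
  rw [h, map_neg]

/-- The bilinear extension of `f` vanishes on two vectors of type `(1,0)`. -/
theorem bilin_one_zero_one_zero (f : F →ₗ[ℝ] F →ₗ[ℝ] G)
    (hf : ∀ u v, f (Complex.I • u) (Complex.I • v) = f u v) (u v : F) :
    f ((1 / 2 : ℝ) • u) ((1 / 2 : ℝ) • v)
        - f (-((1 / 2 : ℝ) • (Complex.I • u))) (-((1 / 2 : ℝ) • (Complex.I • v))) = 0 ∧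
      f ((1 / 2 : ℝ) • u) (-((1 / 2 : ℝ) • (Complex.I • v)))
        + f (-((1 / 2 : ℝ) • (Complex.I • u))) ((1 / 2 : ℝ) • v) = 0 := by
  simp [hf, bilin_I_left f hf u v]

/-- The bilinear extension of `f` on a vector of type `(1,0)` and one of type `(0,1)`. -/
theorem bilin_one_zero_zero_one (f : F →ₗ[ℝ] F →ₗ[ℝ] G)
    (hf : ∀ u v, f (Complex.I • u) (Complex.I • v) = f u v) (u v : F) :
    f ((1 / 2 : ℝ) • u) ((1 / 2 : ℝ) • v)
        - f (-((1 / 2 : ℝ) • (Complex.I • u))) ((1 / 2 : ℝ) • (Complex.I • v)) =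
          (1 / 2 : ℝ) • f u v ∧
      f ((1 / 2 : ℝ) • u) ((1 / 2 : ℝ) • (Complex.I • v))
        + f (-((1 / 2 : ℝ) • (Complex.I • u))) ((1 / 2 : ℝ) • v) =
          (1 / 2 : ℝ) • f u (Complex.I • v) := by
  constructor
  · simp only [map_smul, map_neg, LinearMap.smul_apply, LinearMap.neg_apply, hf]
    module
  · simp only [map_smul, map_neg, LinearMap.smul_apply, LinearMap.neg_apply, bilin_I_left f hf u v]
    module

theorem complex_smul_eq (z : ℂ) (u : F) : z • u = z.re • u + z.im • (Complex.I • u) := by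
  rw [← Complex.coe_smul z.re u, ← Complex.coe_smul z.im, smul_smul, ← add_smul,
    Complex.re_add_im]

theorem bilin_eq_zero_of_basis {m : ℕ} (b : Module.Basis (Fin m) ℂ F) (f : F →ₗ[ℝ] F →ₗ[ℝ] G)
    (hf : ∀ u v, f (Complex.I • u) (Complex.I • v) = f u v)
    (h : ∀ j k, f (b j) (b k) = 0 ∧ f (b j) (Complex.I • b k) = 0) (u v : F) : f u v = 0 := by
  have h1 : ∀ u k, f u (b k) = 0 ∧ f u (Complex.I • b k) = 0 := by
    intro u
    have hu : u ∈ Submodule.span ℂ (Set.range b) := by simp [b.span_eq]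
    induction hu using Submodule.span_induction with
    | mem u hu => obtain ⟨j, rfl⟩ := hu; exact h j
    | zero => simp
    | add u u' _ _ hu hu' => intro k; simp [hu k, hu' k]
    | smul z u _ hu =>
      intro k
      simp only [complex_smul_eq z u, map_add, map_smul, LinearMap.add_apply, LinearMap.smul_apply,
        hu k, hf, bilin_I_left f hf u (b k)]
      simp
  have hv : v ∈ Submodule.span ℂ (Set.range b) := by simp [b.span_eq]
  induction hv using Submodule.span_induction generalizing u with
  | mem v hv => obtain ⟨k, rfl⟩ := hv; exact (h1 u k).1
  | zero => simp
  | add v v' _ _ hv hv' => simp [hv, hv']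
  | smul z v _ hv =>
    have h2 := bilin_I_left f hf u v
    rw [hv, eq_comm, neg_eq_zero] at h2
    rw [complex_smul_eq z v]
    simp [hv, h2]

/-- A real form of type `(1,1)` in terms of its Hermitian form and a complex basis. -/
theorem bilin_eq_sum_basis {m : ℕ} (b : Module.Basis (Fin m) ℂ F) (f : F →ₗ[ℝ] F →ₗ[ℝ] ℂ)
    (hf : ∀ u v, f (Complex.I • u) (Complex.I • v) = f u v) (hswap : ∀ u v, f u v = -f v u)
    (u v : F) :
    Complex.I * ∑ j, ∑ k, (1 / 2 : ℂ) * (f (b j) (Complex.I • b k) - Complex.I * f (b j) (b k)) *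
      (b.repr u j * (starRingEnd ℂ) (b.repr v k) - b.repr v j * (starRingEnd ℂ) (b.repr u k)) =
      f u v := by
  -- the Hermitian form `h`, linear in the first and conjugate linear in the second variable
  let h : F → F → ℂ := fun u v => (1 / 2 : ℂ) * (f u (Complex.I • v) - Complex.I * f u v)
  have hsmul_left : ∀ (z : ℂ) u v, h (z • u) v = z * h u v := fun z u v => by
    simp only [h, complex_smul_eq z u, map_add, map_smul, LinearMap.add_apply,
      LinearMap.smul_apply, hf, bilin_I_left f hf, Complex.real_smul]
    conv_rhs => rw [← Complex.re_add_im z]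
    linear_combination (1 / 2 : ℂ) * z.im * f u v * Complex.I_sq
  have hsmul_right : ∀ (z : ℂ) u v, h u (z • v) = (starRingEnd ℂ) z * h u v := fun z u v => by
    have e : Complex.I • Complex.I • v = -v := by
      rw [smul_smul, Complex.I_mul_I, neg_one_smul]
    have e' : Complex.I • z • v = z.re • (Complex.I • v) + z.im • (-v) := by
      rw [smul_comm, complex_smul_eq z, e]
    have ez : (starRingEnd ℂ) z = z.re - z.im * Complex.I := by
      apply Complex.ext <;> simp
    simp only [h, e']
    simp only [complex_smul_eq z v, map_add, map_smul, map_neg, Complex.real_smul]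
    rw [ez]
    linear_combination (-1 / 2 : ℂ) * z.im * f u v * Complex.I_sq
  have hsum_left : ∀ (g : Fin m → F) v, h (∑ j, g j) v = ∑ j, h (g j) v := fun g v => by
    simp only [h, map_sum, LinearMap.sum_apply, Finset.mul_sum, mul_sub, Finset.sum_sub_distrib]
  have hsum_right : ∀ u (g : Fin m → F), h u (∑ j, g j) = ∑ j, h u (g j) := fun u g => by
    simp only [h, map_sum, Finset.smul_sum, Finset.mul_sum, mul_sub, Finset.sum_sub_distrib]
  have hexp : ∀ u v, h u v = ∑ j, ∑ k, h (b j) (b k) *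
      (b.repr u j * (starRingEnd ℂ) (b.repr v k)) := fun u v => by
    conv_lhs => rw [← b.sum_repr u, ← b.sum_repr v]
    rw [hsum_left]
    refine Finset.sum_congr rfl fun j _ => ?_
    rw [hsum_right]
    refine Finset.sum_congr rfl fun k _ => ?_
    rw [hsmul_left, hsmul_right]
    ring
  have h1 : ∑ j, ∑ k, h (b j) (b k) *
      (b.repr u j * (starRingEnd ℂ) (b.repr v k) - b.repr v j * (starRingEnd ℂ) (b.repr u k)) =
      h u v - h v u := by
    rw [hexp u v, hexp v u]
    simp only [mul_sub, Finset.sum_sub_distrib]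
  rw [show (∑ j, ∑ k, (1 / 2 : ℂ) * (f (b j) (Complex.I • b k) - Complex.I * f (b j) (b k)) *
      (b.repr u j * (starRingEnd ℂ) (b.repr v k) - b.repr v j * (starRingEnd ℂ) (b.repr u k))) =
      h u v - h v u from h1]
  have h2 : f v (Complex.I • u) = f u (Complex.I • v) := by
    rw [hswap, bilin_I_left f hf, neg_neg]
  simp only [h, h2, hswap v u]
  linear_combination (-1 : ℂ) * f u v * Complex.I_sq

end Invariant

/-! ### Complex horizontal vectors -/

section Complexified

variable {E : Type*} [NormedAddCommGroup E] [NormedSpace ℂ E]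
  {F : Type*} [NormedAddCommGroup F] [NormedSpace ℂ F]
  {Q : E →L[ℝ] F} {η : E [⋀^Fin 2]→L[ℝ] ℂ}

theorem evalCplx_eq_toBilin {E : Type*} [NormedAddCommGroup E] [NormedSpace ℝ E]
    (η : E [⋀^Fin 2]→L[ℝ] ℂ) (Z W : Cplx E) :
    evalCplx η Z W = toBilin η Z.re W.re - toBilin η Z.im W.im
      + Complex.I * (toBilin η Z.re W.im + toBilin η Z.im W.re) := by
  simp only [evalCplx, toBilin_apply]

theorem evalCplx_half_smul_real {E : Type*} [NormedAddCommGroup E] [NormedSpace ℝ E]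
    (η : E [⋀^Fin 2]→L[ℝ] ℂ) (a c w : E) :
    evalCplx η ⟨(1 / 2 : ℝ) • a, (1 / 2 : ℝ) • c⟩ ⟨w, 0⟩ =
      Complex.I * ((1 / 2 : ℂ) * (toBilin η c w - Complex.I * toBilin η a w)) := by
  rw [evalCplx_eq_toBilin]
  simp only [map_zero, sub_zero, zero_add, map_smul, smul_apply, Complex.real_smul]
  push_cast
  linear_combination (1 / 2 : ℂ) * toBilin η a w * Complex.I_sq

/-- The pull-back under the horizontal lift of the form `η` to the base. -/
noncomputable def horForm (Q : E →L[ℝ] F) (η : E [⋀^Fin 2]→L[ℝ] ℂ) : F →ₗ[ℝ] F →ₗ[ℝ] ℂ :=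
  LinearMap.mk₂ ℝ (fun u v => toBilin η (realLift Q η u) (realLift Q η v))
    (by simp) (by simp) (by simp) (by simp)

theorem horForm_apply (u v : F) :
    horForm Q η u v = toBilin η (realLift Q η u) (realLift Q η v) := rfl

theorem horForm_swap (u v : F) : horForm Q η u v = -horForm Q η v u :=
  toBilin_swap _ _ _

namespace IsPosOnKer

theorem comp (h : IsPosOnKer Q η) {A : E →L[ℝ] E} (hA : Function.Bijective A)
    (hI : ∀ v, A (Complex.I • v) = Complex.I • A v) :
    IsPosOnKer (Q ∘L A) (η.compContinuousLinearMap A) where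
  surj := h.surj.comp hA.2
  map_I v := by simp [hI, h.map_I]
  real v w := by rw [toBilin_compContinuousLinearMap, h.real]
  type_one_one v w := by
    simp only [toBilin_compContinuousLinearMap, hI, h.type_one_one]
  pos v hv hne := by
    rw [toBilin_compContinuousLinearMap, hI]
    exact h.pos _ hv fun h0 => hne (hA.1 (h0.trans (map_zero A).symm))

variable [FiniteDimensional ℂ E] [FiniteDimensional ℂ F]

theorem horForm_I (h : IsPosOnKer Q η) (u v : F) :
    horForm Q η (Complex.I • u) (Complex.I • v) = horForm Q η u v := by
  rw [horForm_apply, h.realLift_I, h.realLift_I, h.type_one_one, horForm_apply]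

/-- The complex horizontal lift is the complexification of the real one. -/
theorem complexLift_iff (h : IsPosOnKer Q η) (u : Cplx F) (Z : Cplx E) :
    ((∀ W : Cplx E, Q W.re = 0 ∧ Q W.im = 0 → evalCplx η Z W = 0) ∧
      Q Z.re = u.re ∧ Q Z.im = u.im) ↔ Z = ⟨realLift Q η u.re, realLift Q η u.im⟩ := by
  constructor
  · rintro ⟨hW, hre, him⟩
    have key : ∀ w, Q w = 0 → toBilin η Z.re w = 0 ∧ toBilin η Z.im w = 0 := fun w hw => by
      have h1 := hW ⟨w, 0⟩ ⟨hw, map_zero Q⟩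
      rw [evalCplx_eq_toBilin] at h1
      simp only [map_zero, sub_zero, zero_add] at h1
      have h2 := congrArg Complex.re h1
      have h3 := congrArg Complex.im h1
      simp [h.real] at h2 h3
      exact ⟨Complex.ext h2 (h.real _ _), Complex.ext h3 (h.real _ _)⟩
    exact Cplx.ext (h.eq_realLift hre fun w hw => (key w hw).1)
      (h.eq_realLift him fun w hw => (key w hw).2)
  · rintro rfl
    refine ⟨fun W hW => ?_, h.map_realLift _, h.map_realLift _⟩
    simp [evalCplx_eq_toBilin, h.toBilin_realLift _ hW.1, h.toBilin_realLift _ hW.2]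

/-- The Hermitian product of the complex horizontal lifts of two `(1,0)`-vectors. -/
theorem evalCplx_realLift (h : IsPosOnKer Q η) (u v : F) :
    evalCplx η ⟨realLift Q η ((1 / 2 : ℝ) • u), realLift Q η (-((1 / 2 : ℝ) • (Complex.I • u)))⟩
        ⟨Complex.I • realLift Q η ((1 / 2 : ℝ) • v),
          Complex.I • -realLift Q η (-((1 / 2 : ℝ) • (Complex.I • v)))⟩ =
      (1 / 2 : ℂ) * (horForm Q η u (Complex.I • v) - Complex.I * horForm Q η u v) := by
  have e : Complex.I • Complex.I • v = -v := by
    rw [smul_smul, Complex.I_mul_I, neg_one_smul]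
  simp only [evalCplx_eq_toBilin, ← h.realLift_I, ← map_neg, ← horForm_apply]
  simp only [neg_neg, smul_comm Complex.I (1 / 2 : ℝ), map_smul, map_neg, LinearMap.smul_apply,
    LinearMap.neg_apply, bilin_I_left _ h.horForm_I u, e, Complex.real_smul]
  push_cast
  ring

/-- The horizontal lift is natural under a complex linear change of coordinates `A`. -/
theorem map_realLift_comp (h : IsPosOnKer Q η) {A : E →L[ℝ] E} (hA : Function.Bijective A)
    (hI : ∀ v, A (Complex.I • v) = Complex.I • A v) (u : F) :
    A (realLift (Q ∘L A) (η.compContinuousLinearMap A) u) = realLift Q η u := by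
  have h' := h.comp hA hI
  refine h.eq_realLift (h'.map_realLift u) fun w hw => ?_
  obtain ⟨w, rfl⟩ := hA.2 w
  have := h'.toBilin_realLift u hw
  rwa [toBilin_compContinuousLinearMap] at this

theorem horForm_comp (h : IsPosOnKer Q η) {A : E →L[ℝ] E} (hA : Function.Bijective A)
    (hI : ∀ v, A (Complex.I • v) = Complex.I • A v) :
    horForm (Q ∘L A) (η.compContinuousLinearMap A) = horForm Q η := by
  ext u v
  simp only [horForm_apply, toBilin_compContinuousLinearMap, h.map_realLift_comp hA hI]

theorem map_vertProj_comp (h : IsPosOnKer Q η) {A : E →L[ℝ] E} (hA : Function.Bijective A)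
    (hI : ∀ v, A (Complex.I • v) = Complex.I • A v) (v : E) :
    A (vertProj (Q ∘L A) (η.compContinuousLinearMap A) v) = vertProj Q η (A v) := by
  simp [vertProj, h.map_realLift_comp hA hI]

end IsPosOnKer

open VectorField

namespace IsLocalFibration

variable {q : E → F} {η : E → E [⋀^Fin 2]→L[ℝ] ℂ} {x : E}
  [FiniteDimensional ℂ E] [FiniteDimensional ℂ F]

/-- The bracket at `x` of the horizontal lifts of two constant vector fields. -/
noncomputable def liftBracket (h : IsLocalFibration q η x) : F →ₗ[ℝ] F →ₗ[ℝ] E :=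
  have hd : ∀ u, DifferentiableAt ℝ (liftField q η u) x := fun u => (h.projectsTo_liftField u).1
  have hadd : ∀ u v, liftField q η (u + v) = liftField q η u + liftField q η v := fun u v => by
    ext y; simp [liftField]
  have hsmul : ∀ (c : ℝ) u, liftField q η (c • u) = c • liftField q η u := fun c u => by
    ext y; simp [liftField]
  LinearMap.mk₂ ℝ (fun u v => lieBracket ℝ (liftField q η u) (liftField q η v) x)
    (fun u u' v => by rw [hadd, lieBracket_add_left (hd u) (hd u')])
    (fun c u v => by rw [hsmul, lieBracket_const_smul_left (hd u)])
    (fun u v v' => by rw [hadd, lieBracket_add_right (hd v) (hd v')])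
    (fun c u v => by rw [hsmul, lieBracket_const_smul_right (hd v)])

theorem liftBracket_apply (h : IsLocalFibration q η x) (u v : F) :
    h.liftBracket u v = lieBracket ℝ (liftField q η u) (liftField q η v) x := rfl

theorem fderiv_liftBracket (h : IsLocalFibration q η x) (u v : F) :
    fderiv ℝ q x (h.liftBracket u v) = 0 :=
  h.fderiv_lieBracket_liftField u v

/-- The bracket of two horizontal lifts is the Hamiltonian vector field, on the fiber, of the
value of the form on them. -/
theorem toBilin_liftBracket (h : IsLocalFibration q η x) (u v : F) {w : E}
    (hw : fderiv ℝ q x w = 0) : toBilin (η x) (h.liftBracket u v) w =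
      fderiv ℝ (fun y => horForm (fderiv ℝ q y) (η y) u v) x w :=
  h.toBilin_lieBracket_liftField u v hw

/-- The form is of type `(1,1)`, so its value on two horizontal lifts does not change when both are
multiplied by `i`; hence neither does their bracket. -/
theorem liftBracket_I (h : IsLocalFibration q η x) (u v : F) :
    h.liftBracket (Complex.I • u) (Complex.I • v) = h.liftBracket u v := by
  have hI : (fun y => horForm (fderiv ℝ q y) (η y) (Complex.I • u) (Complex.I • v)) =ᶠ[𝓝 x]
      fun y => horForm (fderiv ℝ q y) (η y) u v := h.pos.mono fun y hy => hy.horForm_I u v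
  rw [← sub_eq_zero]
  refine h.pos.self_of_nhds.eq_zero (by simp [h.fderiv_liftBracket]) fun w hw => ?_
  rw [map_sub, sub_apply, h.toBilin_liftBracket _ _ hw,
    h.toBilin_liftBracket _ _ hw, hI.fderiv_eq, sub_self]

theorem contDiffAt_horForm (h : IsLocalFibration q η x) (u v : F) :
    ContDiffAt ℝ ∞ (fun y => horForm (fderiv ℝ q y) (η y) u v) x :=
  ((contDiff_toBilin.contDiffAt.comp x h.contDiffAt_form).clm_apply
    (h.contDiffAt_liftField u)).clm_apply (h.contDiffAt_liftField v)

end IsLocalFibration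

end Complexified

/-! ### Holomorphic maps as real smooth maps -/

section RestrictScalars

variable {E : Type*} [NormedAddCommGroup E] [NormedSpace ℂ E]
  {X : Type*} [TopologicalSpace X] [ChartedSpace E X]
  {F : Type*} [NormedAddCommGroup F] [NormedSpace ℂ F]
  {B : Type*} [TopologicalSpace B] [ChartedSpace F B] {f : X → B} {x : X} {n : ℕ∞ω}

theorem ContMDiffAt.real_of_complex (h : ContMDiffAt 𝓘(ℂ, E) 𝓘(ℂ, F) n f x) :
    ContMDiffAt 𝓘(ℝ, E) 𝓘(ℝ, F) n f x := by
  rw [contMDiffAt_iff] at h ⊢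
  exact ⟨h.1, h.2.restrict_scalars ℝ⟩

theorem MDifferentiableAt.hasMFDerivAt_real (h : MDifferentiableAt 𝓘(ℂ, E) 𝓘(ℂ, F) f x) :
    HasMFDerivAt 𝓘(ℝ, E) 𝓘(ℝ, F) f x
      ((mfderiv 𝓘(ℂ, E) 𝓘(ℂ, F) f x : E →L[ℂ] F).restrictScalars ℝ : E →L[ℝ] F) :=
  ⟨h.hasMFDerivAt.1, HasFDerivWithinAt.restrictScalars ℝ h.hasMFDerivAt.2⟩

/-- The real differential of a map between manifolds, as a linear map between the model spaces. -/
noncomputable def modelDiff (E : Type*) [NormedAddCommGroup E] [NormedSpace ℂ E]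
    (F : Type*) [NormedAddCommGroup F] [NormedSpace ℂ F]
    {X : Type*} [TopologicalSpace X] [ChartedSpace E X]
    {B : Type*} [TopologicalSpace B] [ChartedSpace F B] (f : X → B) (x : X) : E →L[ℝ] F :=
  mfderiv 𝓘(ℝ, E) 𝓘(ℝ, F) f x

theorem MDifferentiableAt.modelDiff_apply (h : MDifferentiableAt 𝓘(ℂ, E) 𝓘(ℂ, F) f x) (v : E) :
    modelDiff E F f x v = (mfderiv 𝓘(ℂ, E) 𝓘(ℂ, F) f x : E →L[ℂ] F) v := by
  rw [modelDiff, h.hasMFDerivAt_real.mfderiv]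
  rfl

theorem MDifferentiableAt.modelDiff_I_smul (h : MDifferentiableAt 𝓘(ℂ, E) 𝓘(ℂ, F) f x) (v : E) :
    modelDiff E F f x (Complex.I • v) = Complex.I • modelDiff E F f x v := by
  rw [h.modelDiff_apply, h.modelDiff_apply]
  exact (mfderiv 𝓘(ℂ, E) 𝓘(ℂ, F) f x : E →L[ℂ] F).map_smul _ _

end RestrictScalars

/-! ### The preferred chart at a point -/

section Chart

variable {E : Type*} [NormedAddCommGroup E] [NormedSpace ℂ E]
  {X : Type*} [TopologicalSpace X] [ChartedSpace E X]
  {F : Type*} [NormedAddCommGroup F] [NormedSpace ℂ F]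
  {B : Type*} [TopologicalSpace B] [ChartedSpace F B]

/-- The form `Ω x`, as a form on the model space. -/
def pointForm (Ω : CForm E X 2) (x : X) : E [⋀^Fin 2]→L[ℝ] ℂ := Ω x

/-- The differential of the inverse of the preferred chart at `x₀`. -/
noncomputable def chartSymmDiff (x₀ : X) (y : E) : E →L[ℝ] E :=
  modelDiff E E (extChartAt 𝓘(ℝ, E) x₀).symm y

theorem chartForm_eq (Ω : CForm E X 2) (x₀ : X) (y : E) :
    chartForm Ω x₀ y = (pointForm Ω ((extChartAt 𝓘(ℝ, E) x₀).symm y)).compContinuousLinearMap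
      (chartSymmDiff x₀ y) := rfl

theorem eventually_mem_target (x : X) :
    ∀ᶠ y in 𝓝 (extChartAt 𝓘(ℝ, E) x x), y ∈ (extChartAt 𝓘(ℝ, E) x).target :=
  (isOpen_extChartAt_target x).mem_nhds (mem_extChartAt_target x)

variable [IsManifold 𝓘(ℂ, E) ω X]

theorem isInvertible_chartSymmDiff {x₀ : X} {y : E} (hy : y ∈ (extChartAt 𝓘(ℝ, E) x₀).target) :
    (chartSymmDiff x₀ y).IsInvertible := by
  have h := isInvertible_mfderivWithin_extChartAt_symm hy
  rw [modelWithCornersSelf_coe, Set.range_id, mfderivWithin_univ] at h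
  exact h

theorem bijective_chartSymmDiff {x₀ : X} {y : E} (hy : y ∈ (extChartAt 𝓘(ℝ, E) x₀).target) :
    Function.Bijective (chartSymmDiff x₀ y) :=
  (isInvertible_chartSymmDiff hy).bijective

theorem chartSymmDiff_I_smul {x₀ : X} {y : E} (hy : y ∈ (extChartAt 𝓘(ℝ, E) x₀).target) (v : E) :
    chartSymmDiff x₀ y (Complex.I • v) = Complex.I • chartSymmDiff x₀ y v := by
  have : IsManifold 𝓘(ℂ, E) 1 X := IsManifold.of_le (n := ω) le_top
  have h : MDifferentiableAt 𝓘(ℂ, E) 𝓘(ℂ, E) (extChartAt 𝓘(ℂ, E) x₀).symm y := by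
    have := mdifferentiableWithinAt_extChartAt_symm (I := 𝓘(ℂ, E)) (x := x₀) (z := y) hy
    rwa [modelWithCornersSelf_coe, Set.range_id, mdifferentiableWithinAt_univ] at this
  exact MDifferentiableAt.modelDiff_I_smul h v

theorem chartSymmDiff_self (x₀ : X) :
    chartSymmDiff x₀ (extChartAt 𝓘(ℝ, E) x₀ x₀) = ContinuousLinearMap.id ℝ E := by
  have h := mfderivWithin_range_extChartAt_symm (I := 𝓘(ℝ, E)) (x := x₀)
  rw [modelWithCornersSelf_coe, Set.range_id, mfderivWithin_univ] at h
  exact h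

theorem chartForm_self (Ω : CForm E X 2) (x : X) :
    chartForm Ω x (extChartAt 𝓘(ℝ, E) x x) = pointForm Ω x := by
  rw [chartForm_eq, chartSymmDiff_self, extChartAt_to_inv]
  ext v
  rfl

/-- The differential at `x` of the preferred chart at `x` is the identity. -/
theorem mextDeriv_eq {k : ℕ} (η : CForm E X k) (x : X) :
    mextDeriv η x = (extDeriv (chartForm η x) (extChartAt 𝓘(ℝ, E) x x) :) := by
  have h := mfderiv_extChartAt_self (I := 𝓘(ℝ, E)) (x := x)
  rw [mextDeriv, h]
  ext v
  rfl

/-- The Lie bracket at `x` is the one of the components `A'` and `B'` of the fields in the preferred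
chart at `x`, whose differential at `x` is the identity. -/
theorem mlieBracket_eq (A B : ∀ x : X, TangentSpace 𝓘(ℝ, E) x) (x : X) {A' B' : E → E}
    (hA : ∀ᶠ y in 𝓝 (extChartAt 𝓘(ℝ, E) x x),
      chartSymmDiff x y (A' y) = A ((extChartAt 𝓘(ℝ, E) x).symm y))
    (hB : ∀ᶠ y in 𝓝 (extChartAt 𝓘(ℝ, E) x x),
      chartSymmDiff x y (B' y) = B ((extChartAt 𝓘(ℝ, E) x).symm y)) :
    VectorField.mlieBracket 𝓘(ℝ, E) A B x =
      (VectorField.lieBracket ℝ A' B' (extChartAt 𝓘(ℝ, E) x x) : E) := by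
  have hT : ∀ᶠ y in 𝓝 (extChartAt 𝓘(ℝ, E) x x), y ∈ (extChartAt 𝓘(ℝ, E) x).target :=
    (isOpen_extChartAt_target x).mem_nhds (mem_extChartAt_target x)
  have key : ∀ (A : ∀ x : X, TangentSpace 𝓘(ℝ, E) x) (A' : E → E),
      (∀ᶠ y in 𝓝 (extChartAt 𝓘(ℝ, E) x x),
        chartSymmDiff x y (A' y) = A ((extChartAt 𝓘(ℝ, E) x).symm y)) →
      ∃ A₁ : E → E, VectorField.mpullbackWithin 𝓘(ℝ, E) 𝓘(ℝ, E) (extChartAt 𝓘(ℝ, E) x).symm A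
        (Set.range 𝓘(ℝ, E)) = A₁ ∧ A₁ =ᶠ[𝓝 (extChartAt 𝓘(ℝ, E) x x)] A' := by
    intro A A' hA
    refine ⟨_, rfl, ?_⟩
    filter_upwards [hA, hT] with y hy hyT
    rw [modelWithCornersSelf_coe, Set.range_id, VectorField.mpullbackWithin_univ]
    change (chartSymmDiff x y).inverse (A ((extChartAt 𝓘(ℝ, E) x).symm y) : E) = A' y
    obtain ⟨e, he⟩ := isInvertible_chartSymmDiff hyT
    rw [← hy, ← he, ContinuousLinearMap.inverse_equiv]
    exact e.symm_apply_apply _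
  obtain ⟨A₁, hA₁, hA₁'⟩ := key A A' hA
  obtain ⟨B₁, hB₁, hB₁'⟩ := key B B' hB
  have h0 : VectorField.mlieBracket 𝓘(ℝ, E) A B x =
      (modelDiff E E (extChartAt 𝓘(ℝ, E) x) x).inverse (VectorField.lieBracketWithin ℝ A₁ B₁
        ((extChartAt 𝓘(ℝ, E) x).symm ⁻¹' Set.univ ∩ Set.range 𝓘(ℝ, E))
        (extChartAt 𝓘(ℝ, E) x x)) := by
    rw [← hA₁, ← hB₁]
    rfl
  have h1 : modelDiff E E (extChartAt 𝓘(ℝ, E) x) x = ContinuousLinearMap.id ℝ E :=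
    mfderiv_extChartAt_self (I := 𝓘(ℝ, E)) (x := x)
  have h2 : (extChartAt 𝓘(ℝ, E) x).symm ⁻¹' Set.univ ∩ Set.range 𝓘(ℝ, E) = Set.univ := by simp
  rw [h0, h1, h2, VectorField.lieBracketWithin_univ, hA₁'.lieBracket_vectorField_eq hB₁',
    ContinuousLinearMap.inverse_id]
  rfl

end Chart

/-! ### Relative Kähler fibrations in a chart -/

section Fibration

variable {E : Type*} [NormedAddCommGroup E] [NormedSpace ℂ E]
  {F : Type*} [NormedAddCommGroup F] [NormedSpace ℂ F]
  {X : Type*} [TopologicalSpace X] [ChartedSpace E X]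
  {B : Type*} [TopologicalSpace B] [ChartedSpace F B]
  {p : X → B} {Ω : CForm E X 2} {t : OpenPartialHomeomorph B F} {x : X}

/-- The projection in the coordinates `t` of the base is holomorphic. -/
theorem IsRelativeKahlerFibration.contMDiffAt_coord
    (hp : IsRelativeKahlerFibration (F := F) p Ω)
    (ht : t ∈ IsManifold.maximalAtlas 𝓘(ℂ, F) ω B) (hx : p x ∈ t.source) :
    ContMDiffAt 𝓘(ℂ, E) 𝓘(ℂ, F) ω (t ∘ p) x :=
  (contMDiffAt_of_mem_maximalAtlas ht hx).comp x (hp.holomorphic x)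

theorem IsRelativeKahlerFibration.modelDiff_coord
    (hp : IsRelativeKahlerFibration (F := F) p Ω)
    (ht : t ∈ IsManifold.maximalAtlas 𝓘(ℂ, F) ω B) (hx : p x ∈ t.source) :
    modelDiff E F (t ∘ p) x = modelDiff F F t (p x) ∘L modelDiff E F p x := by
  have h1 : ContMDiffAt 𝓘(ℂ, F) 𝓘(ℂ, F) ω t (p x) := contMDiffAt_of_mem_maximalAtlas ht hx
  exact mfderiv_comp x ((h1.mdifferentiableAt (by simp)).hasMFDerivAt_real.mdifferentiableAt)
    (((hp.holomorphic x).mdifferentiableAt (by simp)).hasMFDerivAt_real.mdifferentiableAt)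

theorem IsRelativeKahlerFibration.coordDiff_apply [FiniteDimensional ℂ F]
    (hp : IsRelativeKahlerFibration (F := F) p Ω)
    (ht : t ∈ IsManifold.maximalAtlas 𝓘(ℂ, F) ω B) (hx : p x ∈ t.source) {m : ℕ}
    (b : Module.Basis (Fin m) ℂ F) (j : Fin m) (v : E) :
    (coordDiff t b p j x : E →L[ℝ] ℂ) v = b.repr (modelDiff E F (t ∘ p) x v) j := by
  have : FiniteDimensional ℝ F := FiniteDimensional.complexToReal F
  let ℓ : F →L[ℝ] ℂ := LinearMap.toContinuousLinearMap ((b.coord j).restrictScalars ℝ)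
  have h1 : HasMFDerivAt 𝓘(ℝ, E) 𝓘(ℝ, F) (t ∘ p) x (modelDiff E F (t ∘ p) x) :=
    ((hp.contMDiffAt_coord ht hx).mdifferentiableAt
      (by simp)).hasMFDerivAt_real.mdifferentiableAt.hasMFDerivAt
  have h2 := (ℓ.hasMFDerivAt (x := t (p x))).comp x h1
  have h3 : coordDiff t b p j x = (ℓ ∘L modelDiff E F (t ∘ p) x : E →L[ℝ] ℂ) := h2.mfderiv
  rw [h3]
  rfl

variable [IsManifold 𝓘(ℂ, F) ω B]

theorem bijective_modelDiff_chart (ht : t ∈ IsManifold.maximalAtlas 𝓘(ℂ, F) ω B) {y : B}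
    (hy : y ∈ t.source) : Function.Bijective (modelDiff F F t y) := by
  have hI : IsManifold 𝓘(ℂ, F) 1 B := IsManifold.of_le (n := ω) le_top
  have hd : t.MDifferentiable 𝓘(ℝ, F) 𝓘(ℝ, F) := by
    constructor
    · intro z hz
      have h1 : ContMDiffAt 𝓘(ℂ, F) 𝓘(ℂ, F) ω t z := contMDiffAt_of_mem_maximalAtlas ht hz
      exact (h1.mdifferentiableAt
        (by simp)).hasMFDerivAt_real.mdifferentiableAt.mdifferentiableWithinAt
    · intro z hz
      have h2 : ContMDiffAt 𝓘(ℂ, F) 𝓘(ℂ, F) ω t.symm z := contMDiffAt_symm_of_mem_maximalAtlas ht hz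
      exact (h2.mdifferentiableAt
        (by simp)).hasMFDerivAt_real.mdifferentiableAt.mdifferentiableWithinAt
  exact hd.mfderiv_bijective hy

theorem IsRelativeKahlerFibration.isVertical_iff
    (hp : IsRelativeKahlerFibration (F := F) p Ω)
    (ht : t ∈ IsManifold.maximalAtlas 𝓘(ℂ, F) ω B) (hx : p x ∈ t.source) (w : E) :
    IsVertical (F := F) p x w ↔ modelDiff E F (t ∘ p) x w = 0 := by
  rw [hp.modelDiff_coord ht hx, ContinuousLinearMap.comp_apply,
    ← map_zero (modelDiff F F t (p x)), (bijective_modelDiff_chart ht hx).1.eq_iff]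
  rfl

theorem IsRelativeKahlerFibration.isPosOnKer
    (hp : IsRelativeKahlerFibration (F := F) p Ω)
    (ht : t ∈ IsManifold.maximalAtlas 𝓘(ℂ, F) ω B) (hx : p x ∈ t.source) :
    IsPosOnKer (modelDiff E F (t ∘ p) x) (pointForm Ω x) where
  surj := by
    rw [hp.modelDiff_coord ht hx]
    refine (bijective_modelDiff_chart ht hx).2.comp fun u => ?_
    obtain ⟨v, hv⟩ := hp.submersion x u
    exact ⟨v, (((hp.holomorphic x).mdifferentiableAt (by simp)).modelDiff_apply v).trans hv⟩
  map_I v := ((hp.contMDiffAt_coord ht hx).mdifferentiableAt (by simp)).modelDiff_I_smul v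
  real v w := by
    rw [toBilin_apply]
    exact Complex.conj_eq_iff_im.1 (hp.real x ![v, w])
  type_one_one v w := by
    rw [toBilin_apply, toBilin_apply]
    exact hp.type_one_one x v w
  pos v hv hne := by
    rw [toBilin_apply]
    exact hp.positive x v ((hp.isVertical_iff ht hx v).2 hv) hne

section Lift

variable [FiniteDimensional ℂ E] [FiniteDimensional ℂ F]

/-- The complex vector `⟨L (u / 2), L (-i u / 2)⟩`, where `L` is the real horizontal lift defined by
`Q` and `η`: the horizontal lift of the `(1,0)`-vector with real part `u / 2`. -/
noncomputable def complexLift (Q : E →L[ℝ] F) (η : E [⋀^Fin 2]→L[ℝ] ℂ) (u : F) : Cplx E :=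
  ⟨realLift Q η ((1 / 2 : ℝ) • u), realLift Q η (-((1 / 2 : ℝ) • (Complex.I • u)))⟩

theorem IsRelativeKahlerFibration.isHorizontalLiftAt_iff
    (hp : IsRelativeKahlerFibration (F := F) p Ω)
    (ht : t ∈ IsManifold.maximalAtlas 𝓘(ℂ, F) ω B) (hx : p x ∈ t.source) {m : ℕ}
    (b : Module.Basis (Fin m) ℂ F) (j : Fin m) (Z : Cplx (TangentSpace 𝓘(ℝ, E) x)) :
    IsHorizontalLiftAt p Ω x (coordField t b j (p x)) Z ↔
      Z = (complexLift (modelDiff E F (t ∘ p) x) (pointForm Ω x) (b j) : Cplx E) := by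
  have h := (hp.isPosOnKer ht hx).complexLift_iff
    ⟨(1 / 2 : ℝ) • b j, -((1 / 2 : ℝ) • (Complex.I • b j))⟩ Z
  refine Iff.trans (and_congr ?_ ?_) h
  · refine forall_congr' fun W => imp_congr ?_ Iff.rfl
    exact and_congr (hp.isVertical_iff ht hx _) (hp.isVertical_iff ht hx _)
  · have hbij := bijective_modelDiff_chart ht hx
    obtain ⟨e, he⟩ : ∃ e : F ≃L[ℝ] F, (e : F →L[ℝ] F) = modelDiff F F t (p x) := by
      have : FiniteDimensional ℝ F := FiniteDimensional.complexToReal F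
      exact ⟨(LinearEquiv.ofBijective (modelDiff F F t (p x) : F →ₗ[ℝ] F)
        hbij).toContinuousLinearEquiv, by ext; rfl⟩
    have hinv : ∀ u : F, (modelDiff F F t (p x)).inverse u = e.symm u := fun u => by
      rw [← he, ContinuousLinearMap.inverse_equiv]
      rfl
    have key : ∀ v : E, ∀ u : F, modelDiff E F p x v = e.symm u ↔
        modelDiff E F (t ∘ p) x v = u := fun v u => by
      rw [hp.modelDiff_coord ht hx, ← he, e.eq_symm_apply]
      rfl
    rw [Cplx.ext_iff]
    refine and_congr ?_ ?_
    · rw [← key, map_smul, ← hinv]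
      rfl
    · rw [← key, map_neg, map_smul, ← hinv]
      rfl

theorem IsRelativeKahlerFibration.liftV_eq
    (hp : IsRelativeKahlerFibration (F := F) p Ω)
    (ht : t ∈ IsManifold.maximalAtlas 𝓘(ℂ, F) ω B) (hx : p x ∈ t.source) {m : ℕ}
    (b : Module.Basis (Fin m) ℂ F) (j : Fin m) :
    liftV t b p Ω j x =
      (complexLift (modelDiff E F (t ∘ p) x) (pointForm Ω x) (b j) : Cplx E) := by
  have h : ∃ Z, IsHorizontalLiftAt p Ω x (coordField t b j (p x)) Z :=
    ⟨_, (hp.isHorizontalLiftAt_iff ht hx b j _).2 rfl⟩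
  rw [← hp.isHorizontalLiftAt_iff ht hx, liftV, horizontalLift, dif_pos h]
  exact h.choose_spec

theorem IsRelativeKahlerFibration.geodCurv_eq
    (hp : IsRelativeKahlerFibration (F := F) p Ω)
    (ht : t ∈ IsManifold.maximalAtlas 𝓘(ℂ, F) ω B) (hx : p x ∈ t.source) {m : ℕ}
    (b : Module.Basis (Fin m) ℂ F) (j k : Fin m) :
    geodCurv t b p Ω j k x = (1 / 2 : ℂ) *
      (horForm (modelDiff E F (t ∘ p) x) (pointForm Ω x) (b j) (Complex.I • b k) -
        Complex.I * horForm (modelDiff E F (t ∘ p) x) (pointForm Ω x) (b j) (b k)) := by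
  rw [← (hp.isPosOnKer ht hx).evalCplx_realLift, geodCurv, innerForm, hp.liftV_eq ht hx,
    hp.liftV_eq ht hx]
  rfl

/-- Removing the geodesic curvature form leaves the part of `Ω` which lives on vertical vectors. -/
theorem IsRelativeKahlerFibration.sub_geodForm_eq
    (hp : IsRelativeKahlerFibration (F := F) p Ω)
    (ht : t ∈ IsManifold.maximalAtlas 𝓘(ℂ, F) ω B) (hx : p x ∈ t.source) {m : ℕ}
    (b : Module.Basis (Fin m) ℂ F) :
    Ω x - geodForm t b p Ω x = ((pointForm Ω x).compContinuousLinearMap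
      (vertProj (modelDiff E F (t ∘ p) x) (pointForm Ω x)) : E [⋀^Fin 2]→L[ℝ] ℂ) := by
  have h := hp.isPosOnKer ht hx
  have key : ∀ v w : E, geodForm t b p Ω x ![v, w] =
      horForm (modelDiff E F (t ∘ p) x) (pointForm Ω x) (modelDiff E F (t ∘ p) x v)
        (modelDiff E F (t ∘ p) x w) := fun v w => by
    rw [← bilin_eq_sum_basis b _ h.horForm_I horForm_swap]
    simp only [geodForm]
    rw [ContinuousAlternatingMap.smul_apply, smul_eq_mul, ContinuousAlternatingMap.sum_apply]
    congr 1
    refine Finset.sum_congr rfl fun j _ => ?_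
    rw [ContinuousAlternatingMap.sum_apply]
    refine Finset.sum_congr rfl fun k _ => ?_
    rw [ContinuousAlternatingMap.smul_apply, smul_eq_mul, hp.geodCurv_eq ht hx, wedgeOne_apply]
    congr 1
    rw [← hp.coordDiff_apply ht hx, ← hp.coordDiff_apply ht hx, ← hp.coordDiff_apply ht hx,
      ← hp.coordDiff_apply ht hx]
    rfl
  have h2 : ∀ v w : E, (Ω x - geodForm t b p Ω x) ![v, w] = ((pointForm Ω x).compContinuousLinearMap
      (vertProj (modelDiff E F (t ∘ p) x) (pointForm Ω x)) : E [⋀^Fin 2]→L[ℝ] ℂ) ![v, w] := by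
    intro v w
    rw [← toBilin_apply, toBilin_compContinuousLinearMap, h.toBilin_vertProj,
      ContinuousAlternatingMap.sub_apply, key, toBilin_apply]
    rfl
  ext v
  have e : v = ![v 0, v 1] := by ext i; fin_cases i <;> rfl
  rw [e]
  exact h2 _ _

end Lift

end Fibration

/-! ### Smoothness, differentials and brackets through the preferred chart -/

section NearPoint

variable {E : Type*} [NormedAddCommGroup E] [NormedSpace ℂ E]
  {F : Type*} [NormedAddCommGroup F] [NormedSpace ℂ F]
  {X : Type*} [TopologicalSpace X] [ChartedSpace E X] [IsManifold 𝓘(ℂ, E) ω X]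
  {B : Type*} [TopologicalSpace B] [ChartedSpace F B]
  {p : X → B} {Ω : CForm E X 2} {t : OpenPartialHomeomorph B F} {x : X}

/-- A function is smooth at `x` if it is smooth in the preferred chart at `x`. -/
theorem contMDiffAt_of_chart {G : Type*} [NormedAddCommGroup G] [NormedSpace ℝ G] {f : X → G}
    {g : E → G} (hg : ContDiffAt ℝ ∞ g (extChartAt 𝓘(ℝ, E) x x))
    (hfg : ∀ᶠ y in 𝓝 (extChartAt 𝓘(ℝ, E) x x), f ((extChartAt 𝓘(ℝ, E) x).symm y) = g y) :
    ContMDiffAt 𝓘(ℝ, E) 𝓘(ℝ, G) ∞ f x := by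
  have hX : IsManifold 𝓘(ℝ, E) ω X := isManifold_real_of_complex
  have hX' : IsManifold 𝓘(ℝ, E) ∞ X := IsManifold.of_le (n := ω) le_top
  have h1 : ContMDiffAt 𝓘(ℝ, E) 𝓘(ℝ, G) ∞ (g ∘ extChartAt 𝓘(ℝ, E) x) x :=
    ContMDiffAt.comp x hg.contMDiffAt contMDiffAt_extChartAt
  refine h1.congr_of_eventuallyEq ?_
  filter_upwards [(continuousAt_extChartAt (I := 𝓘(ℝ, E)) x).eventually hfg,
    extChartAt_source_mem_nhds (I := 𝓘(ℝ, E)) x] with z hz hz'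
  rw [(extChartAt 𝓘(ℝ, E) x).left_inv hz'] at hz
  exact hz

theorem mfderiv_eq_fderiv_of_chart {G : Type*} [NormedAddCommGroup G] [NormedSpace ℝ G] {f : X → G}
    {g : E → G} (hg : ContDiffAt ℝ ∞ g (extChartAt 𝓘(ℝ, E) x x))
    (hfg : ∀ᶠ y in 𝓝 (extChartAt 𝓘(ℝ, E) x x), f ((extChartAt 𝓘(ℝ, E) x).symm y) = g y) :
    mfderiv 𝓘(ℝ, E) 𝓘(ℝ, G) f x = (fderiv ℝ g (extChartAt 𝓘(ℝ, E) x x) : E →L[ℝ] G) := by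
  have h1 := (contMDiffAt_of_chart hg hfg).mdifferentiableAt (by simp)
  rw [h1.mfderiv, modelWithCornersSelf_coe, Set.range_id, fderivWithin_univ]
  refine Filter.EventuallyEq.fderiv_eq ?_
  filter_upwards [hfg] with y hy
  change extChartAt 𝓘(ℝ, G) (f x) (f ((extChartAt 𝓘(ℝ, E) x).symm y)) = g y
  rw [extChartAt_model_space_eq_id]
  exact hy

/-- A vector field is smooth at `x` if its components in the preferred chart at `x` are. -/
theorem contMDiffAt_section_of_chart {A : ∀ x : X, TangentSpace 𝓘(ℝ, E) x} {A' : E → E}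
    (hA' : ContDiffAt ℝ ∞ A' (extChartAt 𝓘(ℝ, E) x x))
    (hA : ∀ᶠ y in 𝓝 (extChartAt 𝓘(ℝ, E) x x),
      chartSymmDiff x y (A' y) = A ((extChartAt 𝓘(ℝ, E) x).symm y)) :
    ContMDiffAt 𝓘(ℝ, E) 𝓘(ℝ, E).tangent ∞ (fun x => (⟨x, A x⟩ : TangentBundle 𝓘(ℝ, E) X)) x := by
  refine (Bundle.contMDiffAt_section x).2 (contMDiffAt_of_chart hA' ?_)
  filter_upwards [hA, eventually_mem_target x] with y hy hyT
  have hsrc := (extChartAt 𝓘(ℝ, E) x).map_target hyT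
  rw [extChartAt_source] at hsrc
  have hmem : (extChartAt 𝓘(ℝ, E) x).symm y ∈
      (trivializationAt E (TangentSpace 𝓘(ℝ, E)) x).baseSet := hsrc
  have h1 := (trivializationAt E (TangentSpace 𝓘(ℝ, E)) x).continuousLinearMapAt_apply_of_mem
    (R := ℝ) hmem (A ((extChartAt 𝓘(ℝ, E) x).symm y))
  rw [← h1, TangentBundle.continuousLinearMapAt_trivializationAt hsrc, ← hy]
  have h2 := mfderiv_extChartAt_comp_mfderivWithin_extChartAt_symm (I := 𝓘(ℝ, E)) hyT
  rw [modelWithCornersSelf_coe, Set.range_id, mfderivWithin_univ] at h2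
  exact congrArg (fun f : E →L[ℝ] E => f (A' y)) h2

/-- The chain rule for the projection in the preferred chart at `x` and the coordinates `t`. -/
theorem IsRelativeKahlerFibration.eventually_chart
    (hp : IsRelativeKahlerFibration (F := F) p Ω)
    (ht : t ∈ IsManifold.maximalAtlas 𝓘(ℂ, F) ω B) (hx : p x ∈ t.source) :
    ∀ᶠ y in 𝓝 (extChartAt 𝓘(ℝ, E) x x), y ∈ (extChartAt 𝓘(ℝ, E) x).target ∧
      p ((extChartAt 𝓘(ℝ, E) x).symm y) ∈ t.source ∧
      fderiv ℝ (t ∘ p ∘ (extChartAt 𝓘(ℝ, E) x).symm) y =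
        modelDiff E F (t ∘ p) ((extChartAt 𝓘(ℝ, E) x).symm y) ∘L chartSymmDiff x y := by
  have h1 : ∀ᶠ y in 𝓝 (extChartAt 𝓘(ℝ, E) x x),
      p ((extChartAt 𝓘(ℝ, E) x).symm y) ∈ t.source := by
    have hc : ContinuousAt (fun y => p ((extChartAt 𝓘(ℝ, E) x).symm y)) (extChartAt 𝓘(ℝ, E) x x) :=
      (hp.holomorphic.continuous.continuousAt).comp (continuousAt_extChartAt_symm x)
    refine hc (t.open_source.mem_nhds ?_)
    simpa using hx
  filter_upwards [h1, eventually_mem_target x] with y hy hyT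
  refine ⟨hyT, hy, ?_⟩
  have h2 := ((hp.contMDiffAt_coord ht hy).mdifferentiableAt
    (by simp)).hasMFDerivAt_real.mdifferentiableAt
  have h3 : MDifferentiableAt 𝓘(ℝ, E) 𝓘(ℝ, E) (extChartAt 𝓘(ℝ, E) x).symm y := by
    have := mdifferentiableWithinAt_extChartAt_symm (I := 𝓘(ℝ, E)) (x := x) (z := y) hyT
    rwa [modelWithCornersSelf_coe, Set.range_id, mdifferentiableWithinAt_univ] at this
  have h4 := mfderiv_comp y h2 h3
  rw [mfderiv_eq_fderiv] at h4
  exact h4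

theorem IsRelativeKahlerFibration.fderiv_chart
    (hp : IsRelativeKahlerFibration (F := F) p Ω)
    (ht : t ∈ IsManifold.maximalAtlas 𝓘(ℂ, F) ω B) (hx : p x ∈ t.source) :
    fderiv ℝ (t ∘ p ∘ (extChartAt 𝓘(ℝ, E) x).symm) (extChartAt 𝓘(ℝ, E) x x) =
      modelDiff E F (t ∘ p) x := by
  rw [(hp.eventually_chart ht hx).self_of_nhds.2.2, chartSymmDiff_self,
    ContinuousLinearMap.comp_id, extChartAt_to_inv]

variable [IsManifold 𝓘(ℂ, F) ω B]

/-- The fibration, read in the preferred chart at `x` and in the coordinates `t` of the base. -/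
theorem IsRelativeKahlerFibration.isLocalFibration
    (hp : IsRelativeKahlerFibration (F := F) p Ω)
    (ht : t ∈ IsManifold.maximalAtlas 𝓘(ℂ, F) ω B) (hx : p x ∈ t.source) :
    IsLocalFibration (t ∘ p ∘ (extChartAt 𝓘(ℝ, E) x).symm) (chartForm Ω x)
      (extChartAt 𝓘(ℝ, E) x x) where
  contDiffAt_proj := by
    have h := (contMDiffAt_iff.1 (hp.contMDiffAt_coord ht hx).real_of_complex).2
    rw [modelWithCornersSelf_coe, Set.range_id, contDiffWithinAt_univ] at h
    exact ContDiffAt.of_le h le_top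
  contDiffAt_form := (hp.smooth x).contDiffAt (eventually_mem_target x)
  closed := by
    have h := hp.closed x
    rw [mextDeriv_eq] at h
    exact h
  pos := by
    filter_upwards [hp.eventually_chart ht hx] with y hy
    rw [hy.2.2, chartForm_eq]
    exact (hp.isPosOnKer ht hy.2.1).comp (bijective_chartSymmDiff hy.1) (chartSymmDiff_I_smul hy.1)

variable [FiniteDimensional ℂ E] [FiniteDimensional ℂ F]

theorem IsRelativeKahlerFibration.chartSymmDiff_liftField
    (hp : IsRelativeKahlerFibration (F := F) p Ω)
    (ht : t ∈ IsManifold.maximalAtlas 𝓘(ℂ, F) ω B) (hx : p x ∈ t.source) (u : F) :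
    ∀ᶠ y in 𝓝 (extChartAt 𝓘(ℝ, E) x x),
      chartSymmDiff x y (liftField (t ∘ p ∘ (extChartAt 𝓘(ℝ, E) x).symm) (chartForm Ω x) u y) =
        realLift (modelDiff E F (t ∘ p) ((extChartAt 𝓘(ℝ, E) x).symm y))
          (pointForm Ω ((extChartAt 𝓘(ℝ, E) x).symm y)) u := by
  filter_upwards [hp.eventually_chart ht hx] with y hy
  rw [liftField, hy.2.2, chartForm_eq]
  exact (hp.isPosOnKer ht hy.2.1).map_realLift_comp (bijective_chartSymmDiff hy.1)
    (chartSymmDiff_I_smul hy.1) u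

variable {m : ℕ} (b : Module.Basis (Fin m) ℂ F)

/-- The components of the real and imaginary parts of `V_j` in the preferred chart at `x` are
horizontal lifts of constant vector fields. -/
theorem IsRelativeKahlerFibration.chartSymmDiff_liftV
    (hp : IsRelativeKahlerFibration (F := F) p Ω)
    (ht : t ∈ IsManifold.maximalAtlas 𝓘(ℂ, F) ω B) (hx : p x ∈ t.source) (j : Fin m) :
    (∀ᶠ y in 𝓝 (extChartAt 𝓘(ℝ, E) x x), chartSymmDiff x y
      (liftField (t ∘ p ∘ (extChartAt 𝓘(ℝ, E) x).symm) (chartForm Ω x) ((1 / 2 : ℝ) • b j) y) =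
        (liftV t b p Ω j ((extChartAt 𝓘(ℝ, E) x).symm y)).re) ∧
    (∀ᶠ y in 𝓝 (extChartAt 𝓘(ℝ, E) x x), chartSymmDiff x y
      (liftField (t ∘ p ∘ (extChartAt 𝓘(ℝ, E) x).symm) (chartForm Ω x)
        (-((1 / 2 : ℝ) • (Complex.I • b j))) y) =
        (liftV t b p Ω j ((extChartAt 𝓘(ℝ, E) x).symm y)).im) := by
  constructor
  · filter_upwards [hp.chartSymmDiff_liftField ht hx ((1 / 2 : ℝ) • b j),
      hp.eventually_chart ht hx] with y hy hy'
    rw [hy, hp.liftV_eq ht hy'.2.1]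
    rfl
  · filter_upwards [hp.chartSymmDiff_liftField ht hx (-((1 / 2 : ℝ) • (Complex.I • b j))),
      hp.eventually_chart ht hx] with y hy hy'
    rw [hy, hp.liftV_eq ht hy'.2.1]
    rfl

theorem IsRelativeKahlerFibration.isSmoothCFieldOn_liftV
    (hp : IsRelativeKahlerFibration (F := F) p Ω)
    (ht : t ∈ IsManifold.maximalAtlas 𝓘(ℂ, F) ω B) (j : Fin m) :
    IsSmoothCFieldOn (liftV t b p Ω j) (p ⁻¹' t.source) := by
  constructor
  · intro x hx
    exact (contMDiffAt_section_of_chart ((hp.isLocalFibration ht hx).contDiffAt_liftField _)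
      (hp.chartSymmDiff_liftV b ht hx j).1).contMDiffWithinAt
  · intro x hx
    exact (contMDiffAt_section_of_chart ((hp.isLocalFibration ht hx).contDiffAt_liftField _)
      (hp.chartSymmDiff_liftV b ht hx j).2).contMDiffWithinAt

/-- The geodesic curvatures in the preferred chart at `x`. -/
theorem IsRelativeKahlerFibration.geodCurv_chart
    (hp : IsRelativeKahlerFibration (F := F) p Ω)
    (ht : t ∈ IsManifold.maximalAtlas 𝓘(ℂ, F) ω B) (hx : p x ∈ t.source) (j k : Fin m) :
    ∀ᶠ y in 𝓝 (extChartAt 𝓘(ℝ, E) x x),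
      geodCurv t b p Ω j k ((extChartAt 𝓘(ℝ, E) x).symm y) = (1 / 2 : ℂ) *
        (horForm (fderiv ℝ (t ∘ p ∘ (extChartAt 𝓘(ℝ, E) x).symm) y) (chartForm Ω x y)
          (b j) (Complex.I • b k) -
        Complex.I * horForm (fderiv ℝ (t ∘ p ∘ (extChartAt 𝓘(ℝ, E) x).symm) y) (chartForm Ω x y)
          (b j) (b k)) := by
  filter_upwards [hp.eventually_chart ht hx] with y hy
  rw [hp.geodCurv_eq ht hy.2.1, hy.2.2, chartForm_eq,
    (hp.isPosOnKer ht hy.2.1).horForm_comp (bijective_chartSymmDiff hy.1)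
      (chartSymmDiff_I_smul hy.1)]

theorem IsRelativeKahlerFibration.contMDiffAt_geodCurv
    (hp : IsRelativeKahlerFibration (F := F) p Ω)
    (ht : t ∈ IsManifold.maximalAtlas 𝓘(ℂ, F) ω B) (hx : p x ∈ t.source) (j k : Fin m) :
    ContMDiffAt 𝓘(ℝ, E) 𝓘(ℝ, ℂ) ∞ (geodCurv t b p Ω j k) x :=
  have h := hp.isLocalFibration ht hx
  contMDiffAt_of_chart (contDiffAt_const.mul ((h.contDiffAt_horForm _ _).sub
    (contDiffAt_const.mul (h.contDiffAt_horForm _ _)))) (hp.geodCurv_chart b ht hx j k)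

/-- The differentials of the geodesic curvatures along the fiber are given by brackets of real
horizontal lifts. -/
theorem IsRelativeKahlerFibration.cDiff_geodCurv
    (hp : IsRelativeKahlerFibration (F := F) p Ω)
    (ht : t ∈ IsManifold.maximalAtlas 𝓘(ℂ, F) ω B) (hx : p x ∈ t.source) (j k : Fin m) {w : E}
    (hw : modelDiff E F (t ∘ p) x w = 0) :
    (cDiff (geodCurv t b p Ω j k) x : E →L[ℝ] ℂ) w = (1 / 2 : ℂ) *
      (toBilin (pointForm Ω x) ((hp.isLocalFibration ht hx).liftBracket (b j) (Complex.I • b k)) w -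
      Complex.I * toBilin (pointForm Ω x) ((hp.isLocalFibration ht hx).liftBracket (b j) (b k)) w)
    := by
  have h := hp.isLocalFibration ht hx
  have hw' : fderiv ℝ (t ∘ p ∘ (extChartAt 𝓘(ℝ, E) x).symm) (extChartAt 𝓘(ℝ, E) x x) w = 0 := by
    rw [hp.fderiv_chart ht hx, hw]
  have hd : ∀ u v, DifferentiableAt ℝ (fun y => horForm
      (fderiv ℝ (t ∘ p ∘ (extChartAt 𝓘(ℝ, E) x).symm) y) (chartForm Ω x y) u v)
      (extChartAt 𝓘(ℝ, E) x x) := fun u v => (h.contDiffAt_horForm u v).differentiableAt (by simp)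
  have hd' := ((hd (b j) (Complex.I • b k)).hasFDerivAt.sub
    ((hd (b j) (b k)).hasFDerivAt.const_mul Complex.I)).const_mul (1 / 2 : ℂ)
  have e := (mfderiv_eq_fderiv_of_chart (contDiffAt_const.mul ((h.contDiffAt_horForm _ _).sub
    (contDiffAt_const.mul (h.contDiffAt_horForm _ _)))) (hp.geodCurv_chart b ht hx j k)).trans
    hd'.fderiv
  rw [cDiff, e, ← chartForm_self, h.toBilin_liftBracket _ _ hw', h.toBilin_liftBracket _ _ hw']
  rfl

/-- The horizontal lifts of the `∂/∂t^j` commute, as brackets of real horizontal lifts do not change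
when both vectors are multiplied by `i`. -/
theorem IsRelativeKahlerFibration.cBracket_liftV
    (hp : IsRelativeKahlerFibration (F := F) p Ω)
    (ht : t ∈ IsManifold.maximalAtlas 𝓘(ℂ, F) ω B) (hx : p x ∈ t.source) (j k : Fin m) :
    cBracket (liftV t b p Ω j) (liftV t b p Ω k) x = 0 := by
  have h := hp.isLocalFibration ht hx
  have hj := hp.chartSymmDiff_liftV b ht hx j
  have hk := hp.chartSymmDiff_liftV b ht hx k
  rw [cBracket, mlieBracket_eq _ _ x hj.1 hk.1, mlieBracket_eq _ _ x hj.2 hk.2,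
    mlieBracket_eq _ _ x hj.1 hk.2, mlieBracket_eq _ _ x hj.2 hk.1]
  simp only [← h.liftBracket_apply]
  have e := bilin_one_zero_one_zero _ h.liftBracket_I (b j) (b k)
  exact Cplx.ext e.1 e.2

/-- The brackets of the `V_j` and their conjugates in terms of the brackets of real horizontal
lifts. -/
theorem IsRelativeKahlerFibration.cBracket_liftV_conj
    (hp : IsRelativeKahlerFibration (F := F) p Ω)
    (ht : t ∈ IsManifold.maximalAtlas 𝓘(ℂ, F) ω B) (hx : p x ∈ t.source) (j k : Fin m) :
    cBracket (liftV t b p Ω j) (liftV t b p Ω k).conj x =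
      (⟨(1 / 2 : ℝ) • (hp.isLocalFibration ht hx).liftBracket (b j) (b k),
        (1 / 2 : ℝ) • (hp.isLocalFibration ht hx).liftBracket (b j) (Complex.I • b k)⟩ : Cplx E) :=
    by
  have h := hp.isLocalFibration ht hx
  have hj := hp.chartSymmDiff_liftV b ht hx j
  have hk := hp.chartSymmDiff_liftV b ht hx k
  have hk' : ∀ᶠ y in 𝓝 (extChartAt 𝓘(ℝ, E) x x), chartSymmDiff x y
      (liftField (t ∘ p ∘ (extChartAt 𝓘(ℝ, E) x).symm) (chartForm Ω x)
        ((1 / 2 : ℝ) • (Complex.I • b k)) y) =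
        ((liftV t b p Ω k).conj ((extChartAt 𝓘(ℝ, E) x).symm y)).im := by
    filter_upwards [hk.2] with y hy
    rw [liftField, map_neg, map_neg] at hy
    exact (neg_eq_iff_eq_neg.1 hy)
  have e1 := mlieBracket_eq (fun y => (liftV t b p Ω j y).re)
    (fun y => ((liftV t b p Ω k).conj y).re) x hj.1 hk.1
  have e2 := mlieBracket_eq (fun y => (liftV t b p Ω j y).im)
    (fun y => ((liftV t b p Ω k).conj y).im) x hj.2 hk'
  have e3 := mlieBracket_eq (fun y => (liftV t b p Ω j y).re)
    (fun y => ((liftV t b p Ω k).conj y).im) x hj.1 hk'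
  have e4 := mlieBracket_eq (fun y => (liftV t b p Ω j y).im)
    (fun y => ((liftV t b p Ω k).conj y).re) x hj.2 hk.1
  rw [cBracket, e1, e2, e3, e4]
  simp only [← h.liftBracket_apply]
  have e := bilin_one_zero_zero_one _ h.liftBracket_I (b j) (b k)
  exact Cplx.ext e.1 e.2

end NearPoint

/-! ### Powers and differential of the form without its horizontal part, brackets of the lifts -/

section Conclusions

variable {E : Type*} [NormedAddCommGroup E] [NormedSpace ℂ E] [FiniteDimensional ℂ E]
  {F : Type*} [NormedAddCommGroup F] [NormedSpace ℂ F] [FiniteDimensional ℂ F]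

/-- The projection `vertProj Q η` takes its values in `ker Q`, which has real dimension
`2 * (dim E - dim F) < 2 * k`, so that it maps any `2 * k` vectors to dependent ones. -/
theorem IsPosOnKer.wedgePow_vertForm_eq_zero {Q : E →L[ℝ] F} {η : E [⋀^Fin 2]→L[ℝ] ℂ}
    (h : IsPosOnKer Q η) {k : ℕ} (hk : Module.finrank ℂ E < Module.finrank ℂ F + k)
    (v : Fin (2 * k) → E) :
    wedgePow (η.compContinuousLinearMap (vertProj Q η)) k v = 0 := by
  have : FiniteDimensional ℝ E := FiniteDimensional.complexToReal E
  rw [wedgePow_compContinuousLinearMap]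
  refine wedgePow_eq_zero_of_linearDependent _ _ fun hli => ?_
  let K : Submodule ℝ E := LinearMap.ker (Q : E →ₗ[ℝ] F)
  let v' : Fin (2 * k) → K := fun i => ⟨vertProj Q η (v i), h.map_vertProj _⟩
  have hli' : LinearIndependent ℝ v' := LinearIndependent.of_comp K.subtype hli
  have h1 := hli'.fintype_card_le_finrank
  have h2 := (Q : E →ₗ[ℝ] F).finrank_range_add_finrank_ker
  rw [LinearMap.range_eq_top.2 h.surj, finrank_top, finrank_real_of_complex,
    finrank_real_of_complex] at h2
  rw [Fintype.card_fin] at h1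
  change 2 * k ≤ Module.finrank ℝ (LinearMap.ker (Q : E →ₗ[ℝ] F)) at h1
  omega

variable {X : Type*} [TopologicalSpace X] [ChartedSpace E X]
  {B : Type*} [TopologicalSpace B] [ChartedSpace F B] [IsManifold 𝓘(ℂ, F) ω B]
  {p : X → B} {Ω : CForm E X 2} {t : OpenPartialHomeomorph B F} {x : X}
  {m : ℕ} (b : Module.Basis (Fin m) ℂ F)

namespace IsRelativeKahlerFibration

theorem wedgePow_sub_geodForm (hp : IsRelativeKahlerFibration (F := F) p Ω)
    (ht : t ∈ IsManifold.maximalAtlas 𝓘(ℂ, F) ω B) (hx : p x ∈ t.source) {k : ℕ}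
    (hk : Module.finrank ℂ E < Module.finrank ℂ F + k)
    (v : Fin (2 * k) → TangentSpace 𝓘(ℝ, E) x) :
    wedgePow (Ω x - geodForm t b p Ω x) k v = 0 :=
  (congrArg (fun η : E [⋀^Fin 2]→L[ℝ] ℂ => wedgePow η k v) (hp.sub_geodForm_eq ht hx b)).trans
    ((hp.isPosOnKer ht hx).wedgePow_vertForm_eq_zero hk v)

variable [IsManifold 𝓘(ℂ, E) ω X]

theorem isVerticalC_cBracket_conj (hp : IsRelativeKahlerFibration (F := F) p Ω)
    (ht : t ∈ IsManifold.maximalAtlas 𝓘(ℂ, F) ω B) (hx : p x ∈ t.source) (j k : Fin m) :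
    IsVerticalC (F := F) p x (cBracket (liftV t b p Ω j) (liftV t b p Ω k).conj x) := by
  have h := hp.isLocalFibration ht hx
  have key : ∀ u v, IsVertical (F := F) p x ((1 / 2 : ℝ) • h.liftBracket u v : E) := fun u v => by
    rw [hp.isVertical_iff ht hx, map_smul, ← hp.fderiv_chart ht hx, h.fderiv_liftBracket, smul_zero]
  rw [hp.cBracket_liftV_conj b ht hx]
  exact ⟨key _ _, key _ _⟩

/-- The contraction of `[V_j, V̄_k]` with `Ω` on the fibers. -/
theorem evalCplx_cBracket_conj (hp : IsRelativeKahlerFibration (F := F) p Ω)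
    (ht : t ∈ IsManifold.maximalAtlas 𝓘(ℂ, F) ω B) (hx : p x ∈ t.source) (j k : Fin m)
    (w : TangentSpace 𝓘(ℝ, E) x) (hw : IsVertical (F := F) p x w) :
    evalCplx (Ω x) (cBracket (liftV t b p Ω j) (liftV t b p Ω k).conj x) ⟨w, 0⟩ =
      Complex.I * cDiff (geodCurv t b p Ω j k) x w := by
  have h := hp.isLocalFibration ht hx
  have hw' := (hp.isVertical_iff ht hx w).1 hw
  have h1 := hp.cDiff_geodCurv b ht hx j k hw'
  rw [hp.cBracket_liftV_conj b ht hx]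
  exact (evalCplx_half_smul_real (pointForm Ω x) _ _ w).trans
    (congrArg (fun z => Complex.I * z) h1).symm

/-- By `cBracket_liftV_conj`, and since brackets of real horizontal lifts are invariant under
multiplication by `i`, they vanish if they do on a complex basis and its multiples by `i`. -/
theorem cBracket_conj_eq_zero_iff (hp : IsRelativeKahlerFibration (F := F) p Ω)
    (ht : t ∈ IsManifold.maximalAtlas 𝓘(ℂ, F) ω B) (hx : p x ∈ t.source) :
    (∀ j k, cBracket (liftV t b p Ω j) (liftV t b p Ω k).conj x = 0) ↔
      ∀ u v, (hp.isLocalFibration ht hx).liftBracket u v = 0 := by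
  have h := hp.isLocalFibration ht hx
  constructor
  · intro h0
    refine bilin_eq_zero_of_basis b _ h.liftBracket_I fun j k => ?_
    have h1 := h0 j k
    rw [hp.cBracket_liftV_conj b ht hx] at h1
    have hre : (1 / 2 : ℝ) • h.liftBracket (b j) (b k) = 0 := congrArg Cplx.re h1
    have him : (1 / 2 : ℝ) • h.liftBracket (b j) (Complex.I • b k) = 0 := congrArg Cplx.im h1
    exact ⟨(smul_eq_zero.1 hre).resolve_left (by norm_num),
      (smul_eq_zero.1 him).resolve_left (by norm_num)⟩
  · intro h0 j k
    rw [hp.cBracket_liftV_conj b ht hx, h0, h0, smul_zero]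
    rfl

/-- In the preferred chart at `x` this is `IsLocalFibration.extDeriv_vertForm_eq_zero_iff`. -/
theorem mextDeriv_sub_geodForm_eq_zero_iff (hp : IsRelativeKahlerFibration (F := F) p Ω)
    (ht : t ∈ IsManifold.maximalAtlas 𝓘(ℂ, F) ω B) (hx : p x ∈ t.source) :
    mextDeriv (fun x => Ω x - geodForm t b p Ω x) x = 0 ↔
      ∀ u v, (hp.isLocalFibration ht hx).liftBracket u v = 0 := by
  have h := hp.isLocalFibration ht hx
  have key : chartForm (fun x => Ω x - geodForm t b p Ω x) x
      =ᶠ[𝓝 (extChartAt 𝓘(ℝ, E) x x)] fun y => (chartForm Ω x y).compContinuousLinearMap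
        (vertProj (fderiv ℝ (t ∘ p ∘ (extChartAt 𝓘(ℝ, E) x).symm) y) (chartForm Ω x y)) := by
    filter_upwards [hp.eventually_chart ht hx] with y hy
    have h1 : pointForm (fun x => Ω x - geodForm t b p Ω x) ((extChartAt 𝓘(ℝ, E) x).symm y) = _ :=
      hp.sub_geodForm_eq ht hy.2.1 b
    rw [chartForm_eq, h1, hy.2.2, chartForm_eq]
    ext v
    simp only [ContinuousAlternatingMap.compContinuousLinearMap_apply]
    congr 1
    funext i
    exact ((hp.isPosOnKer ht hy.2.1).map_vertProj_comp (bijective_chartSymmDiff hy.1)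
      (chartSymmDiff_I_smul hy.1) (v i)).symm
  rw [mextDeriv_eq, key.extDeriv_eq]
  exact h.extDeriv_vertForm_eq_zero_iff

end IsRelativeKahlerFibration

end Conclusions

theorem mainTheorem6
    {E : Type*} [NormedAddCommGroup E] [NormedSpace ℂ E] [FiniteDimensional ℂ E]
    {F : Type*} [NormedAddCommGroup F] [NormedSpace ℂ F] [FiniteDimensional ℂ F]
    {X : Type*} [TopologicalSpace X] [ChartedSpace E X] [IsManifold 𝓘(ℂ, E) ω X]
    {B : Type*} [TopologicalSpace B] [ChartedSpace F B] [IsManifold 𝓘(ℂ, F) ω B]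
    {m n : ℕ} (hdim : Module.finrank ℂ E = m + n)
    (p : X → B) (Ω : CForm E X 2) (hp : IsRelativeKahlerFibration (F := F) p Ω)
    (t : OpenPartialHomeomorph B F) (ht : t ∈ IsManifold.maximalAtlas 𝓘(ℂ, F) ω B)
    (b : Module.Basis (Fin m) ℂ F) :
    let S : Set X := p ⁻¹' t.source
    let V : Fin m → CField E X := liftV t b p Ω
    let c : Fin m → Fin m → X → ℂ := geodCurv t b p Ω
    let Ω' : CForm E X 2 := fun x => Ω x - geodForm t b p Ω x
    -- the `V_j` are the unique horizontal lifts of the `∂/∂t^j`; everything is smooth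
    (∀ j, ∀ x ∈ S, ∀ Z, IsHorizontalLiftAt p Ω x (coordField t b j (p x)) Z ↔ Z = V j x) ∧
    (∀ j, IsSmoothCFieldOn (V j) S) ∧
    (∀ j k, ContMDiffOn 𝓘(ℝ, E) 𝓘(ℝ, ℂ) ∞ (c j k) S) ∧
    -- (1)
    (∀ j k, ∀ x ∈ S, cBracket (V j) (V k) x = 0) ∧
    -- (2)
    (∀ x ∈ S, ∀ v, wedgePow (Ω' x) (n + 1) v = 0) ∧
    -- (3)
    (∀ j k, ∀ x ∈ S, IsVerticalC (F := F) p x (cBracket (V j) (V k).conj x) ∧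
      ∀ w : TangentSpace 𝓘(ℝ, E) x, IsVertical (F := F) p x w →
        evalCplx (Ω x) (cBracket (V j) (V k).conj x) ⟨w, 0⟩ =
          Complex.I * cDiff (c j k) x w) ∧
    -- (4)
    ((∀ j k, ∀ x ∈ S, cBracket (V j) (V k).conj x = 0) ↔ ∀ x ∈ S, mextDeriv Ω' x = 0) := by
  refine ⟨fun j x hx Z => ?_, fun j => hp.isSmoothCFieldOn_liftV b ht j,
    fun j k x hx => (hp.contMDiffAt_geodCurv b ht hx j k).contMDiffWithinAt,
    fun j k x hx => hp.cBracket_liftV b ht hx j k, fun x hx v => ?_,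
    fun j k x hx => ⟨hp.isVerticalC_cBracket_conj b ht hx j k,
      fun w hw => hp.evalCplx_cBracket_conj b ht hx j k w hw⟩, ?_⟩
  · rw [hp.isHorizontalLiftAt_iff ht hx, hp.liftV_eq ht hx]
  · refine hp.wedgePow_sub_geodForm b ht hx ?_ v
    rw [hdim, Module.finrank_eq_card_basis b, Fintype.card_fin]
    omega
  · constructor
    · intro h x hx
      rw [hp.mextDeriv_sub_geodForm_eq_zero_iff b ht hx, ← hp.cBracket_conj_eq_zero_iff b ht hx]
      exact fun j k => h j k x hx
    · intro h j k x hx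
      have h1 := (hp.mextDeriv_sub_geodForm_eq_zero_iff b ht hx).1 (h x hx)
      exact (hp.cBracket_conj_eq_zero_iff b ht hx).2 h1 j k
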